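/- All graphs are finite, simple and undirected. For an edge-coloring $c$ of a graph $G$, a path of $G$ is called distance $2$-proper if no two edges of the same color appear on it with fewer than two edges in between. For a connected graph $G$, let $pc_{1,2}(G)$ be the minimum number of colors in an edge-coloring of $G$ such that every two distinct vertices of $G$ are joined by a distance $2$-proper path. Let $C_m$ be the cycle on $m$ vertices and $S_m=K_{1,m-1}$ the star on $m$ vertices. For $n_1,n_2\ge 1$ let $T(n_1,n_2)$ be the double star: two adjacent centers $u,v$ together with $n_1$ leaves adjacent to $u$ and $n_2$ leaves adjacent to $v$. Let $T^1(n_1,n_2)$ be the tree obtained from $T(n_1,n_2)$ by replacing the pendent edge between $u$ and one of its leaves by a path with two edges. Let $G_1,\dots,G_8$ be the following graphs. - $G_1$ (paw): vertices $0,\dots,3$, edges $01,02,12,03$. - $G_2$ (diamond): vertices $0,\dots,3$, edges $01,02,03,12,13$. - $G_3$ (cricket): vertices $0,\dots,4$, edges $01,02,12,03,04$. - $G_4$ (bull): vertices $0,\dots,4$, edges $01,02,12,03,14$. - $G_5$ (kite, a diamond with a pendent vertex at a vertex of degree two): vertices $0,\dots,4$, edges $01,02,03,12,13,24$. - $G_6$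 (triangle with a pendent path of two edges): vertices $0,\dots,4$, edges $01,02,12,03,34$. - $G_7$ (banner, a $4$-cycle with a pendent vertex): vertices $0,\dots,4$, edges $01,12,23,03,04$. - $G_8$: vertices $0,\dots,5$, edges $01,02,12,03,34,35$. Theorem. Let $G$ be a connected graph on $n\ge 2$ vertices. Then (i) $pc_{1,2}(G)=n-1$ if and only if $G$ is isomorphic to $S_n$ or to $T(n_1,n_2)$ for some $n_1,n_2\ge 1$; (ii) $pc_{1,2}(G)=n-2$ if and only if $G$ is isomorphic to one of $C_3$, $C_4$, $C_5$, $G_1,\dots,G_8$, or to $T^1(n_1,n_2)$ for some $n_1,n_2\ge 1$. -/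

import Mathlib

namespace DistanceProper

/-- For an edge-colouring `c` of `G`, a walk (in the use below: a path) is *distance `ℓ`-proper* if
no two of its edges of the same colour have fewer than `ℓ` edges between them on it. For positions
`i < j` in the list of edges there are exactly `j - i - 1` edges strictly in between. -/
def IsDistanceProper {V K : Type*} {G : SimpleGraph V} (c : G.EdgeLabeling K) (ℓ : ℕ) {u v : V}
    (p : G.Walk u v) : Prop :=
  ∀ (i j : ℕ) (hi : i < p.edges.length) (hj : j < p.edges.length), i < j → j - i - 1 < ℓ →
    c ⟨p.edges[i], p.edges_subset_edgeSet (List.getElem_mem hi)⟩ ≠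
      c ⟨p.edges[j], p.edges_subset_edgeSet (List.getElem_mem hj)⟩

/-- `c` is a *`(k, ℓ)`-proper-path colouring* of `G`: any two distinct vertices are joined by `k`
(different) pairwise internally vertex-disjoint distance `ℓ`-proper paths. -/
def IsProperPathColoring {V K : Type*} (G : SimpleGraph V) (c : G.EdgeLabeling K) (k ℓ : ℕ) :
    Prop :=
  ∀ u v : V, u ≠ v → ∃ P : Fin k → G.Path u v,
    Function.Injective P ∧
    (∀ i, IsDistanceProper c ℓ (P i : G.Walk u v)) ∧
    ∀ i j, i ≠ j → ∀ x, x ∈ (P i : G.Walk u v).support → x ∈ (P j : G.Walk u v).support →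
      x = u ∨ x = v

/-- The *`(k, ℓ)`-proper connection number* `pc_{k,ℓ}(G)`: the least number `t` of colours that
suffice for a `(k, ℓ)`-proper-path colouring of `G`. (For a finite connected graph and `k = 1`
the set is nonempty, since all edges may receive different colours.) -/
noncomputable def properConnectionNumber (k ℓ : ℕ) {V : Type*} (G : SimpleGraph V) : ℕ :=
  sInf {t : ℕ | ∃ c : G.EdgeLabeling (Fin t), IsProperPathColoring G c k ℓ}

/-- The double star `T(n₁, n₂)`: the two centres `inl 0`, `inl 1` are adjacent, the first one has
the `n₁` leaves `inr (inl a)` and the second one the `n₂` leaves `inr (inr b)`. -/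
def doubleStar (n₁ n₂ : ℕ) : SimpleGraph (Fin 2 ⊕ (Fin n₁ ⊕ Fin n₂)) :=
  SimpleGraph.fromRel fun x y => match x, y with
    | .inl i, .inl j => i ≠ j
    | .inl i, .inr (.inl _) => i = 0
    | .inl i, .inr (.inr _) => i = 1
    | _, _ => False

/-- The tree `T¹(n₁, n₂)` for `1 ≤ n₁`: in `T(n₁, n₂)` the pendent edge from the first centre to its
leaf number `0` is replaced by a path with two edges; that is, a new pendent vertex `none` is joined
to that leaf. -/
def extendedDoubleStar (n₁ n₂ : ℕ) : SimpleGraph (Option (Fin 2 ⊕ (Fin n₁ ⊕ Fin n₂))) :=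
  SimpleGraph.fromRel fun x y => match x, y with
    | some x, some y => (doubleStar n₁ n₂).Adj x y
    | none, some (.inr (.inl a)) => a.val = 0
    | _, _ => False

/-- The paw: a triangle `0 1 2` with a pendent vertex `3` at `0`. -/
def G₁ : SimpleGraph (Fin 4) :=
  SimpleGraph.fromEdgeSet {s(0, 1), s(0, 2), s(1, 2), s(0, 3)}

/-- The diamond: `K₄` without the edge `2 3`. -/
def G₂ : SimpleGraph (Fin 4) :=
  SimpleGraph.fromEdgeSet {s(0, 1), s(0, 2), s(0, 3), s(1, 2), s(1, 3)}

/-- The cricket: a triangle `0 1 2` with two pendent vertices `3`, `4` at `0`. -/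
def G₃ : SimpleGraph (Fin 5) :=
  SimpleGraph.fromEdgeSet {s(0, 1), s(0, 2), s(1, 2), s(0, 3), s(0, 4)}

/-- The bull: a triangle `0 1 2` with pendent vertices `3` at `0` and `4` at `1`. -/
def G₄ : SimpleGraph (Fin 5) :=
  SimpleGraph.fromEdgeSet {s(0, 1), s(0, 2), s(1, 2), s(0, 3), s(1, 4)}

/-- The kite: a diamond (`K₄` on `0 1 2 3` without the edge `2 3`) with a pendent vertex `4` at the
vertex `2` of degree two. -/
def G₅ : SimpleGraph (Fin 5) :=
  SimpleGraph.fromEdgeSet {s(0, 1), s(0, 2), s(0, 3), s(1, 2), s(1, 3), s(2, 4)}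

/-- A triangle `0 1 2` with a pendent path `0 3 4` of two edges at `0`. -/
def G₆ : SimpleGraph (Fin 5) :=
  SimpleGraph.fromEdgeSet {s(0, 1), s(0, 2), s(1, 2), s(0, 3), s(3, 4)}

/-- The banner: a cycle `0 1 2 3` with a pendent vertex `4` at `0`. -/
def G₇ : SimpleGraph (Fin 5) :=
  SimpleGraph.fromEdgeSet {s(0, 1), s(1, 2), s(2, 3), s(0, 3), s(0, 4)}

/-- A triangle `0 1 2` and an edge `0 3` whose end `3` carries two pendent vertices `4`, `5`; this is
`T(2, 2)` with an edge joining the two leaves of one centre. -/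
def G₈ : SimpleGraph (Fin 6) :=
  SimpleGraph.fromEdgeSet {s(0, 1), s(0, 2), s(1, 2), s(0, 3), s(3, 4), s(3, 5)}

end DistanceProper

/-!
Write `n` for the number of vertices of a connected graph and say that a graph *saves* `n - t`
colours if `t` colours are enough to join any two of its vertices by a distance `2`-proper path.
The theorem describes the graphs that save at most one, and exactly two, colours.

Saving is monotone: if a connected graph contains, not necessarily as an induced subgraph, a graph
that saves `s` colours, then it saves `s` colours as well, because the remaining vertices can be
attached one after another by edges of new colours (`ColorableWith.of_isContained`). A single edge
saves one colour; a triangle, a four-cycle and a path on five vertices save two (`twoSavers`); and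
`threeSavers` lists fifteen small graphs that save three. It remains to see that a connected graph
`G` without any of these fifteen is one of the graphs in the theorem, and that those graphs do not
save more than claimed.

* If `G` is acyclic, it is built up by attaching vertices. A star grows into a star or a double
  star, a double star into a double star or a tree `T¹(n₁, n₂)`, and such a tree into another one,
  unless one of the three trees in `threeSavers` appears (`exists_spanning_tree`).
* If `G` has a cycle, it contains a triangle, a four-cycle or a five-cycle, as longer cycles contain
  the path on six vertices. Attaching pendent vertices to one of the nine unicyclic exceptional
  graphs gives such a graph again or a graph of `threeSavers` (`exceptional_pendant`), so one of
  them spans `G`. Adding edges to an exceptional graph likewise stays among the exceptional graphs or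
  produces a graph of `threeSavers` (`exceptional_edge`), so a spanning exceptional subgraph with as
  many edges as possible is all of `G` (`exists_iso_exceptional`).
* In an acyclic graph the paths are unique, hence all of them are distance `2`-proper, and the edges
  that meet a given edge `uv` must have pairwise different colours (`card_le_of_isAcyclic`). This is
  the lower bound for the three families of trees.
* For the eleven exceptional graphs all colourings with `n - 3` colours are tried
  (`exceptional_hasNoColoring`).

The finitely many checks about concrete graphs are evaluated by the kernel, for graphs given by
lists of edges.
-/

namespace DistanceProper

open SimpleGraph

/-! ### Colour sequences and distance `2`-proper paths -/

/-- A list of colours in which equal colours have at least two entries between them: the colour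
sequence of a distance `2`-proper path. -/
def IsSpread {K : Type*} : List K → Prop
  | [] => True
  | a :: l => a ∉ l.take 2 ∧ IsSpread l

instance {K : Type*} [DecidableEq K] : DecidablePred (IsSpread (K := K)) := fun l => by
  induction l with
  | nil => exact isTrue trivial
  | cons a l ih => exact instDecidableAnd

theorem isSpread_iff {K : Type*} {l : List K} :
    IsSpread l ↔ ∀ (i j : ℕ) (hi : i < l.length) (hj : j < l.length), i < j → j - i - 1 < 2 →
      l[i] ≠ l[j] := by
  induction l with
  | nil => simp [IsSpread]
  | cons a l ih =>
    rw [IsSpread, ih, List.mem_take_iff_getElem]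
    constructor
    · rintro ⟨h0, h⟩ (_ | i) (_ | j) hi hj hij hd
      · omega
      · rintro hc
        refine h0 ⟨j, ?_, ?_⟩
        · simp at hj ⊢; omega
        · simpa using hc.symm
      · omega
      · simpa using h i j (by simpa using hi) (by simpa using hj) (by omega) (by omega)
    · intro h
      refine ⟨?_, fun i j hi hj hij hd => ?_⟩
      · rintro ⟨j, hj, hc⟩
        exact h 0 (j + 1) (by simp) (by simp; omega) (by omega) (by omega) (by simpa using hc.symm)
      · exact h (i + 1) (j + 1) (Nat.succ_lt_succ hi) (Nat.succ_lt_succ hj) (by omega) (by omega)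

theorem IsSpread.reverse {K : Type*} {l : List K} (h : IsSpread l) : IsSpread l.reverse := by
  rw [isSpread_iff] at h ⊢
  intro i j hi hj hij hd
  simp only [List.length_reverse] at hi hj
  rw [List.getElem_reverse, List.getElem_reverse]
  exact (h _ _ (by omega) (by omega) (by omega) (by omega)).symm

/-- Some path from `u` to `v` is distance `2`-proper for the colouring `c`, a colouring of all
unordered pairs of which only the values on edges matter. -/
def HasProperPath {V : Type*} (G : SimpleGraph V) (c : Sym2 V → ℕ) (u v : V) : Prop :=
  ∃ p : G.Walk u v, p.IsPath ∧ IsSpread (p.edges.map c)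

theorem HasProperPath.refl {V : Type*} (G : SimpleGraph V) (c : Sym2 V → ℕ) (u : V) :
    HasProperPath G c u u :=
  ⟨.nil, .nil, trivial⟩

/-- `G` has an edge colouring with the colours `0, …, t - 1` in which any two vertices are joined
by a distance `2`-proper path. -/
def ColorableWith {V : Type*} (G : SimpleGraph V) (t : ℕ) : Prop :=
  ∃ c : Sym2 V → ℕ, (∀ e ∈ G.edgeSet, c e < t) ∧ ∀ u v, HasProperPath G c u v

theorem ColorableWith.mono {V : Type*} {G : SimpleGraph V} {s t : ℕ} (h : ColorableWith G s)
    (hst : s ≤ t) : ColorableWith G t := by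
  obtain ⟨c, hc, hp⟩ := h
  exact ⟨c, fun e he => (hc e he).trans_le hst, hp⟩

theorem isDistanceProper_iff {V K : Type*} {G : SimpleGraph V} {c : G.EdgeLabeling K}
    {c' : Sym2 V → ℕ} {f : K → ℕ} (hf : Function.Injective f)
    (hc : ∀ e (he : e ∈ G.edgeSet), c' e = f (c ⟨e, he⟩)) {u v : V} (p : G.Walk u v) :
    IsDistanceProper c 2 p ↔ IsSpread (p.edges.map c') := by
  simp only [isSpread_iff, IsDistanceProper, List.length_map, List.getElem_map]
  refine forall₂_congr fun i j => forall₂_congr fun hi hj => ?_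
  rw [hc _ (p.edges_subset_edgeSet (List.getElem_mem hi)),
    hc _ (p.edges_subset_edgeSet (List.getElem_mem hj)), hf.ne_iff]

theorem exists_isProperPathColoring_iff {V : Type*} {G : SimpleGraph V} {t : ℕ} :
    (∃ c : G.EdgeLabeling (Fin t), IsProperPathColoring G c 1 2) ↔ ColorableWith G t := by
  classical
  constructor
  · rintro ⟨c, hc⟩
    refine ⟨fun e => if he : e ∈ G.edgeSet then (c ⟨e, he⟩ : ℕ) else 0, fun e he => ?_,
      fun u v => ?_⟩
    · simp [he]
    · rcases eq_or_ne u v with rfl | huv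
      · exact .refl ..
      · obtain ⟨P, -, hP, -⟩ := hc u v huv
        exact ⟨P 0, (P 0).2, (isDistanceProper_iff (c := c) Fin.val_injective
          (fun e he => by simp [he]) _).1 (hP 0)⟩
  · rintro ⟨c, hc, hp⟩
    refine ⟨fun e => ⟨c e.1, hc e.1 e.2⟩, fun u v huv => ?_⟩
    obtain ⟨p, hpath, hs⟩ := hp u v
    refine ⟨fun _ => ⟨p, hpath⟩, Function.injective_of_subsingleton _, fun _ => ?_,
      fun i j hij => (hij (Subsingleton.elim i j)).elim⟩
    exact (isDistanceProper_iff Fin.val_injective (fun e he => rfl) p).2 hs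

theorem properConnectionNumber_eq {V : Type*} (G : SimpleGraph V) :
    properConnectionNumber 1 2 G = sInf {t | ColorableWith G t} := by
  simp only [properConnectionNumber, exists_isProperPathColoring_iff]

theorem ColorableWith.properConnectionNumber_le {V : Type*} {G : SimpleGraph V} {t : ℕ}
    (h : ColorableWith G t) : properConnectionNumber 1 2 G ≤ t := by
  rw [properConnectionNumber_eq]
  exact Nat.sInf_le h

/-! ### Colouring a graph from a coloured subgraph -/

/-- In a connected graph, a nonempty proper set of vertices has a neighbour outside it. -/
theorem exists_adj_notMem {V : Type*} {G : SimpleGraph V} (hG : G.Connected) {S : Set V}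
    (hS : S.Nonempty) (hS' : S ≠ Set.univ) : ∃ x ∈ S, ∃ y ∉ S, G.Adj x y := by
  obtain ⟨u, hu⟩ := hS
  obtain ⟨v, hv⟩ := (Set.ne_univ_iff_exists_notMem S).1 hS'
  obtain ⟨d, -, hd, hd'⟩ := (hG.preconnected u v).some.exists_boundary_dart S hu hv
  exact ⟨_, hd, _, hd', d.adj⟩

/-- If a part `S` of the vertices is properly connected inside `S`, then one vertex outside `S` can
be attached to it by an edge of a new colour. -/
theorem exists_coloring_insert {V : Type*} [DecidableEq V] {G : SimpleGraph V} {S : Finset V}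
    {s : ℕ} {c : Sym2 V → ℕ} (hc : ∀ e, c e < s)
    (hp : ∀ u ∈ S, ∀ v ∈ S, ∃ p : G.Walk u v, p.IsPath ∧ IsSpread (p.edges.map c) ∧
      ∀ z ∈ p.support, z ∈ S) {x y : V} (hx : x ∈ S) (hy : y ∉ S) (hxy : G.Adj x y) :
    ∃ c' : Sym2 V → ℕ, (∀ e, c' e < s + 1) ∧
      ∀ u ∈ insert y S, ∀ v ∈ insert y S, ∃ p : G.Walk u v, p.IsPath ∧
        IsSpread (p.edges.map c') ∧ ∀ z ∈ p.support, z ∈ insert y S := by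
  set c' := Function.update c s(y, x) s with hc'
  have hold : ∀ {u v : V} (p : G.Walk u v), (∀ z ∈ p.support, z ∈ S) →
      p.edges.map c' = p.edges.map c := by
    intro u v p hps
    refine List.map_congr_left fun e he => Function.update_of_ne ?_ _ _
    rintro rfl
    exact hy (hps _ (p.fst_mem_support_of_mem_edges he))
  have hnew : ∀ v ∈ S, ∃ p : G.Walk y v, p.IsPath ∧ IsSpread (p.edges.map c') ∧
      ∀ z ∈ p.support, z ∈ insert y S := by
    intro v hv
    obtain ⟨p, hpath, hsp, hps⟩ := hp x hx v hv
    refine ⟨.cons hxy.symm p, hpath.cons fun h => hy (hps _ h), ?_, ?_⟩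
    · rw [Walk.edges_cons, List.map_cons, hold p hps]
      refine ⟨fun h => ?_, hsp⟩
      obtain ⟨e, -, he⟩ := List.mem_map.1 (List.mem_of_mem_take h)
      have := hc e
      simp [hc'] at he
      omega
    · simp only [Walk.support_cons, List.mem_cons, Finset.mem_insert]
      rintro z (rfl | hz)
      · exact .inl rfl
      · exact .inr (hps z hz)
  refine ⟨c', fun e => ?_, fun u hu v hv => ?_⟩
  · rw [hc', Function.update_apply]
    split_ifs
    · omega
    · exact (hc e).trans (Nat.lt_succ_self s)
  · rw [Finset.mem_insert] at hu hv
    rcases hu with rfl | hu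
    · rcases hv with rfl | hv
      · exact ⟨.nil, .nil, trivial, by simp⟩
      · exact hnew v hv
    · rcases hv with rfl | hv
      · obtain ⟨p, hpath, hsp, hps⟩ := hnew u hu
        refine ⟨p.reverse, hpath.reverse, ?_, by simpa using hps⟩
        rw [Walk.edges_reverse, List.map_reverse]
        exact hsp.reverse
      · obtain ⟨p, hpath, hsp, hps⟩ := hp u hu v hv
        exact ⟨p, hpath, by rwa [hold p hps], fun z hz => Finset.mem_insert_of_mem (hps z hz)⟩

/-- The difference between the number of vertices and the number of colours does not drop in
passing to a connected graph that contains the given one. -/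
theorem ColorableWith.of_isContained {V W : Type*} [Fintype V] [Fintype W] [Nonempty W]
    {G : SimpleGraph V} {H : SimpleGraph W} (hG : G.Connected) (hHG : H ⊑ G) {t : ℕ} (ht : 0 < t)
    (hH : ColorableWith H t) : ColorableWith G (t + (Fintype.card V - Fintype.card W)) := by
  classical
  obtain ⟨f⟩ := hHG
  obtain ⟨c, hc, hp⟩ := hH
  have hf : Function.Injective f := f.injective
  have hcard : Fintype.card W ≤ Fintype.card V := Fintype.card_le_of_injective f hf
  suffices ∀ k, Fintype.card W + k ≤ Fintype.card V → ∃ S : Finset V, S.card = Fintype.card W + k ∧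
      ∃ c' : Sym2 V → ℕ, (∀ e, c' e < t + k) ∧ ∀ u ∈ S, ∀ v ∈ S, ∃ p : G.Walk u v, p.IsPath ∧
        IsSpread (p.edges.map c') ∧ ∀ z ∈ p.support, z ∈ S by
    obtain ⟨S, hS, c', hc', hp'⟩ := this (Fintype.card V - Fintype.card W) (by omega)
    have hS' : S = Finset.univ := (Finset.card_eq_iff_eq_univ S).1 (by omega)
    subst hS'
    refine ⟨c', fun e _ => hc' e, fun u v => ?_⟩
    obtain ⟨p, hpath, hsp, -⟩ := hp' u (Finset.mem_univ _) v (Finset.mem_univ _)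
    exact ⟨p, hpath, hsp⟩
  intro k
  induction k with
  | zero =>
    intro _
    -- Pairs of `W` that are no edges may have colours above `t`; they are recoloured with `0`.
    let d : Sym2 W → ℕ := fun e => if e ∈ H.edgeSet then c e else 0
    have hinj : Function.Injective (Sym2.map f) := Sym2.map.injective hf
    refine ⟨Finset.univ.map ⟨f, hf⟩, by simp, Function.extend (Sym2.map f) d 0, fun e => ?_, ?_⟩
    · by_cases he : ∃ e', Sym2.map f e' = e
      · obtain ⟨e', rfl⟩ := he
        rw [hinj.extend_apply]
        by_cases he' : e' ∈ H.edgeSet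
        · simpa [d, he'] using hc e' he'
        · simpa [d, he'] using ht
      · rw [Function.extend_apply' _ _ _ he]
        simpa using ht
    · simp only [Finset.mem_map, Finset.mem_univ, true_and, Function.Embedding.coeFn_mk]
      rintro _ ⟨u, rfl⟩ _ ⟨v, rfl⟩
      obtain ⟨p, hpath, hsp⟩ := hp u v
      refine ⟨p.map f.toHom, hpath.map hf, ?_, ?_⟩
      · rw [Walk.edges_map, List.map_map]
        convert hsp using 1
        refine List.map_congr_left fun e he => ?_
        rw [Function.comp_apply]
        refine (hinj.extend_apply d 0 e).trans ?_
        simp [d, p.edges_subset_edgeSet he]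
      · intro z hz
        rw [Walk.support_map, List.mem_map] at hz
        obtain ⟨w, -, rfl⟩ := hz
        exact ⟨w, rfl⟩
  | succ k ih =>
    intro hk
    obtain ⟨S, hS, c', hc', hp'⟩ := ih (by omega)
    have hne : S.Nonempty := by
      rw [← Finset.card_pos, hS]
      have := Fintype.card_pos (α := W)
      omega
    have hnu : (S : Set V) ≠ Set.univ := by
      intro h
      rw [Finset.coe_eq_univ] at h
      rw [h, Finset.card_univ] at hS
      omega
    obtain ⟨x, hx, y, hy, hxy⟩ := exists_adj_notMem hG (S := (S : Set V)) (by simpa using hne) hnu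
    obtain ⟨c'', hc'', hp''⟩ := exists_coloring_insert hc' hp' hx hy hxy
    refine ⟨insert y S, ?_, c'', hc'', hp''⟩
    rw [Finset.card_insert_of_notMem hy, hS]
    rfl

/-- Isomorphic graphs can be coloured with the same numbers of colours. -/
theorem ColorableWith.of_iso {V W : Type*} {G : SimpleGraph V} {H : SimpleGraph W} (e : H ≃g G)
    {t : ℕ} (hH : ColorableWith H t) : ColorableWith G t := by
  obtain ⟨c, hc, hp⟩ := hH
  refine ⟨fun x => c (x.map e.symm), fun x hx => hc _ ?_, fun u v => ?_⟩
  · induction x with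
    | _ a b => simpa [e.symm.map_adj_iff] using hx
  · obtain ⟨p, hpath, hsp⟩ := hp (e.symm u) (e.symm v)
    refine ⟨(p.map e.toHom).copy (by simp) (by simp), ?_, ?_⟩
    · simpa using hpath.map e.injective
    · rw [Walk.edges_copy, Walk.edges_map, List.map_map]
      convert hsp using 1
      refine List.map_congr_left fun x _ => ?_
      induction x with
      | _ a b => simp

/-! ### Graphs given by lists of edges -/

/-- The graph on `0, …, m - 1` whose edges are the pairs in `E`. The smaller end of an edge is
written first; pairs in the other order are ignored. -/
def edgeGraph (m : ℕ) (E : List (ℕ × ℕ)) : SimpleGraph (Fin m) where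
  Adj i j := i ≠ j ∧ (min i.val j.val, max i.val j.val) ∈ E
  symm := ⟨fun i j h => ⟨h.1.symm, by rw [min_comm, max_comm]; exact h.2⟩⟩
  loopless := ⟨fun _ h => h.1 rfl⟩

instance (m : ℕ) (E : List (ℕ × ℕ)) : DecidableRel (edgeGraph m E).Adj := fun i j =>
  inferInstanceAs (Decidable (i ≠ j ∧ (min i.val j.val, max i.val j.val) ∈ E))

/-- The colour of a pair of vertices in a list of coloured edges. -/
def edgeColor {m : ℕ} (L : List ((ℕ × ℕ) × ℕ)) : Sym2 (Fin m) → ℕ :=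
  Sym2.lift ⟨fun i j => (L.lookup (min i.val j.val, max i.val j.val)).getD 0,
    fun i j => by simp only [min_comm, max_comm]⟩

/-- The vertex lists of the paths from `u` to `v` in `edgeGraph m E` that have at most `k` edges
and avoid the vertices in `vis`. -/
def pathsFrom (m : ℕ) (E : List (ℕ × ℕ)) (v : Fin m) :
    ℕ → List (Fin m) → Fin m → List (List (Fin m))
  | 0, _, u => if u = v then [[u]] else []
  | k + 1, vis, u => if u = v then [[u]] else
      ((List.finRange m).filter fun y => (edgeGraph m E).Adj u y ∧ y ∉ vis).flatMap fun y =>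
        (pathsFrom m E v k (u :: vis) y).map (u :: ·)

/-- The colours of the edges along a list of vertices. -/
def colorsAlong {V : Type*} (c : Sym2 V → ℕ) : List V → List ℕ
  | x :: y :: l => c s(x, y) :: colorsAlong c (y :: l)
  | _ => []

theorem colorsAlong_support {V : Type*} {G : SimpleGraph V} (c : Sym2 V → ℕ) {u v : V}
    (p : G.Walk u v) : colorsAlong c p.support = p.edges.map c := by
  induction p with
  | nil => rfl
  | cons h p ih =>
    cases p with
    | nil => rfl
    | cons h' p =>
      change _ :: colorsAlong c (Walk.cons h' p).support = _
      rw [ih]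
      rfl

theorem mem_pathsFrom {m : ℕ} {E : List (ℕ × ℕ)} {v : Fin m} {k : ℕ} {vis : List (Fin m)}
    {u : Fin m} (hu : u ∉ vis) {l : List (Fin m)} :
    l ∈ pathsFrom m E v k vis u ↔ ∃ p : (edgeGraph m E).Walk u v, p.IsPath ∧ p.length ≤ k ∧
      (∀ x ∈ p.support, x ∉ vis) ∧ p.support = l := by
  induction k generalizing vis u l with
  | zero =>
    rw [pathsFrom]
    constructor
    · intro h
      split_ifs at h with huv
      · subst huv
        rw [List.mem_singleton] at h
        exact ⟨.nil, .nil, by simp, by simpa using hu, by simp [h]⟩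
      · simp at h
    · rintro ⟨p, -, hk, -, rfl⟩
      cases p with
      | nil => simp
      | cons h p => simp at hk
  | succ k ih =>
    rw [pathsFrom]
    constructor
    · intro h
      split_ifs at h with huv
      · subst huv
        rw [List.mem_singleton] at h
        exact ⟨.nil, .nil, by simp, by simpa using hu, by simp [h]⟩
      · simp only [List.mem_flatMap, List.mem_filter, List.mem_finRange, true_and,
          decide_eq_true_eq, List.mem_map] at h
        obtain ⟨y, ⟨hadj, hy⟩, l', hl', rfl⟩ := h
        obtain ⟨p, hp, hk, hvis, rfl⟩ := (ih (by
          rw [List.mem_cons, not_or]; exact ⟨hadj.ne', hy⟩)).1 hl'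
        refine ⟨.cons hadj p, hp.cons fun hmem => hvis u hmem (by simp), by simpa using hk, ?_,
          by simp⟩
        simp only [Walk.support_cons, List.mem_cons]
        rintro x (rfl | hx)
        · exact hu
        · exact fun h => hvis x hx (List.mem_cons_of_mem _ h)
    · rintro ⟨p, hp, hk, hvis, rfl⟩
      cases p with
      | nil => simp
      | @cons _ y _ h p =>
        rw [Walk.cons_isPath_iff] at hp
        have huv : u ≠ v := by
          rintro rfl
          exact hp.2 p.end_mem_support
        rw [if_neg huv]
        simp only [List.mem_flatMap, List.mem_filter, List.mem_finRange, true_and,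
          decide_eq_true_eq, List.mem_map]
        have hyv : y ∉ vis := hvis y (by simp)
        refine ⟨y, ⟨h, hyv⟩, p.support, (ih ?_).2 ⟨p, hp.1, by simpa using hk, fun x hx => ?_, rfl⟩,
          by simp⟩
        · rw [List.mem_cons, not_or]
          exact ⟨h.ne', hyv⟩
        · rw [List.mem_cons, not_or]
          refine ⟨?_, hvis x (by simp [hx])⟩
          rintro rfl
          exact hp.2 hx

/-- Whether `u` and `v` are joined by a distance `2`-proper path, computed by trying all paths. -/
def hasProperPath (m : ℕ) (E : List (ℕ × ℕ)) (L : List ((ℕ × ℕ) × ℕ)) (u v : Fin m) : Bool :=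
  (pathsFrom m E v m [] u).any fun l => IsSpread (colorsAlong (edgeColor L) l)

theorem hasProperPath_iff {m : ℕ} {E : List (ℕ × ℕ)} {L : List ((ℕ × ℕ) × ℕ)} {u v : Fin m} :
    hasProperPath m E L u v = true ↔ HasProperPath (edgeGraph m E) (edgeColor L) u v := by
  simp only [hasProperPath, List.any_eq_true, decide_eq_true_eq, HasProperPath,
    mem_pathsFrom List.not_mem_nil]
  constructor
  · rintro ⟨l, ⟨p, hp, -, -, rfl⟩, hs⟩
    exact ⟨p, hp, by rwa [← colorsAlong_support]⟩
  · rintro ⟨p, hp, hs⟩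
    refine ⟨_, ⟨p, hp, ?_, by simp, rfl⟩, by rwa [colorsAlong_support]⟩
    simpa using hp.length_lt.le

/-- Whether a list of coloured edges is a colouring with `t` colours in which any two vertices are
joined by a distance `2`-proper path. -/
def isColoring (m t : ℕ) (L : List ((ℕ × ℕ) × ℕ)) : Bool :=
  L.all (fun e => L.lookup e.1 = some e.2 ∧ e.2 < t) &&
    (List.finRange m).all fun u => (List.finRange m).all fun v =>
      hasProperPath m (L.map Prod.fst) L u v

theorem colorableWith_of_isColoring {m t : ℕ} {L : List ((ℕ × ℕ) × ℕ)}
    (h : isColoring m t L = true) : ColorableWith (edgeGraph m (L.map Prod.fst)) t := by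
  simp only [isColoring, Bool.and_eq_true, List.all_eq_true, List.mem_finRange, true_implies,
    decide_eq_true_eq] at h
  refine ⟨edgeColor L, fun e he => ?_, fun u v => hasProperPath_iff.1 (h.2 u v)⟩
  induction e with
  | _ i j =>
    obtain ⟨-, he⟩ := he
    obtain ⟨e, heL, he⟩ := List.mem_map.1 he
    obtain ⟨h1, h2⟩ := h.1 e heL
    rw [he] at h1
    simpa [edgeColor, h1] using h2

/-- All colourings of a list of edges with `t` colours. -/
def allColorings (t : ℕ) : List (ℕ × ℕ) → List (List ((ℕ × ℕ) × ℕ))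
  | [] => [[]]
  | e :: E => (List.range t).flatMap fun a => (allColorings t E).map ((e, a) :: ·)

theorem map_mem_allColorings {t : ℕ} {E : List (ℕ × ℕ)} {f : ℕ × ℕ → ℕ} (h : ∀ e ∈ E, f e < t) :
    E.map (fun e => (e, f e)) ∈ allColorings t E := by
  induction E with
  | nil => simp [allColorings]
  | cons e E ih =>
    simp only [allColorings, List.mem_flatMap, List.mem_range, List.mem_map, List.map_cons]
    exact ⟨f e, h e (by simp), _, ih fun e he => h e (by simp [he]), rfl⟩

theorem lookup_map {E : List (ℕ × ℕ)} {f : ℕ × ℕ → ℕ} {e : ℕ × ℕ} (he : e ∈ E) :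
    (E.map fun e => (e, f e)).lookup e = some (f e) := by
  induction E with
  | nil => simp at he
  | cons e' E ih =>
    by_cases h : e = e'
    · subst h
      simp
    · rw [List.map_cons, List.lookup_cons, beq_eq_false_iff_ne.2 h]
      exact ih ((List.mem_cons.1 he).resolve_left h)

/-- Whether every colouring with `t` colours leaves some pair of vertices without a distance
`2`-proper path. -/
def hasNoColoring (m : ℕ) (E : List (ℕ × ℕ)) (t : ℕ) : Bool :=
  (E.all fun e => e.1 < e.2 ∧ e.2 < m) && (allColorings t E).all fun L =>
    (List.finRange m).any fun u => (List.finRange m).any fun v => !hasProperPath m E L u v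

theorem not_colorableWith_of_hasNoColoring {m t : ℕ} {E : List (ℕ × ℕ)}
    (h : hasNoColoring m E t = true) : ¬ ColorableWith (edgeGraph m E) t := by
  rintro ⟨c, hc, hp⟩
  simp only [hasNoColoring, Bool.and_eq_true, List.all_eq_true, decide_eq_true_eq, List.any_eq_true,
    Bool.not_eq_true'] at h
  let f : ℕ × ℕ → ℕ := fun e => if h : e.1 < m ∧ e.2 < m then c s(⟨e.1, h.1⟩, ⟨e.2, h.2⟩) else 0
  have hf : ∀ i j : Fin m, (edgeGraph m E).Adj i j →
      f (min i.val j.val, max i.val j.val) = c s(i, j) := by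
    intro i j hij
    rcases le_total i j with hle | hle
    · have hle' : i.val ≤ j.val := hle
      simp [f, min_eq_left hle', max_eq_right hle']
    · have hle' : j.val ≤ i.val := hle
      simp [f, min_eq_right hle', max_eq_left hle', Sym2.eq_swap]
  have hcol : ∀ e ∈ (edgeGraph m E).edgeSet,
      edgeColor (E.map fun e => (e, f e)) e = c e := by
    intro e he
    induction e with
    | _ i j => simp [edgeColor, lookup_map he.2, hf i j he]
  obtain ⟨u, -, v, -, hq⟩ := h.2 (E.map fun e => (e, f e)) <| map_mem_allColorings <| by
    rintro ⟨a, b⟩ he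
    obtain ⟨hab, hb⟩ := h.1 _ he
    have hab' : a < b := hab
    have hb' : b < m := hb
    simp only [f, hb', hab'.trans hb', and_self, dif_pos]
    refine hc _ ⟨?_, ?_⟩
    · simpa [Fin.ext_iff] using hab'.ne
    · simpa [min_eq_left hab'.le, max_eq_right hab'.le] using he
  refine absurd (hasProperPath_iff.2 ?_) (Bool.eq_false_iff.1 hq)
  obtain ⟨p, hpath, hs⟩ := hp u v
  refine ⟨p, hpath, ?_⟩
  rwa [List.map_congr_left fun e he => hcol e (p.edges_subset_edgeSet he)]

/-! ### Containment of graphs given by lists of edges -/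

theorem edgeGraph_isContained {V : Type*} {G : SimpleGraph V} {m : ℕ} {E : List (ℕ × ℕ)}
    (f : Fin m → V) (hf : Function.Injective f)
    (h : ∀ i j : Fin m, (i.val, j.val) ∈ E → i ≠ j → G.Adj (f i) (f j)) : edgeGraph m E ⊑ G := by
  refine ⟨⟨⟨f, ?_⟩, hf⟩⟩
  rintro i j ⟨hij, he⟩
  rcases le_total i j with hle | hle
  · have hle' : i.val ≤ j.val := hle
    rw [min_eq_left hle', max_eq_right hle'] at he
    exact h i j he hij
  · have hle' : j.val ≤ i.val := hle
    rw [min_eq_right hle', max_eq_left hle'] at he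
    exact (h j i he hij.symm).symm

theorem edgeGraph_isContained_of_list {V : Type*} {G : SimpleGraph V} {m : ℕ} {E : List (ℕ × ℕ)}
    (s : List V) (hs : s.Nodup) (hm : s.length = m)
    (h : ∀ e ∈ E, ∃ x ∈ s[e.1]?, ∃ y ∈ s[e.2]?, G.Adj x y) : edgeGraph m E ⊑ G := by
  subst hm
  refine edgeGraph_isContained s.get (List.nodup_iff_injective_get.1 hs) fun i j he _ => ?_
  obtain ⟨x, hx, y, hy, hxy⟩ := h _ he
  simp only [Fin.is_lt, List.getElem?_eq_getElem, Option.mem_def, Option.some.injEq] at hx hy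
  subst hx hy
  exact hxy

/-- Whether the list `s` of `m` vertices of `edgeGraph m' E'` is a copy of `edgeGraph m E`. -/
def isCopy (m : ℕ) (E : List (ℕ × ℕ)) (m' : ℕ) (E' : List (ℕ × ℕ)) (s : List ℕ) : Bool :=
  s.length == m && decide s.Nodup && s.all (· < m') && E.all fun e =>
    match s[e.1]?, s[e.2]? with
    | some x, some y => x != y && E'.contains (min x y, max x y)
    | _, _ => false

/-- Backtracking search for a list that extends `s` by `k` vertices to a copy of `edgeGraph m E` in
`edgeGraph m' E'`. -/
def searchCopy (m : ℕ) (E : List (ℕ × ℕ)) (m' : ℕ) (E' : List (ℕ × ℕ)) : ℕ → List ℕ → Bool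
  | 0, s => isCopy m E m' E' s
  | k + 1, s => (List.range m').any fun y =>
      !s.contains y &&
      (E.all fun e => e.2 != s.length ||
        match s[e.1]? with
        | some x => E'.contains (min x y, max x y)
        | none => false) &&
      searchCopy m E m' E' k (s ++ [y])

theorem isContained_of_isCopy {m m' : ℕ} {E E' : List (ℕ × ℕ)} {s : List ℕ}
    (h : isCopy m E m' E' s = true) : edgeGraph m E ⊑ edgeGraph m' E' := by
  simp only [isCopy, Bool.and_eq_true, beq_iff_eq, decide_eq_true_eq, List.all_eq_true] at h
  obtain ⟨⟨⟨hm, hnd⟩, hlt⟩, hE⟩ := h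
  refine edgeGraph_isContained_of_list (s.pmap (fun x hx => (⟨x, hx⟩ : Fin m')) hlt)
    (hnd.pmap fun a ha b hb hab => by simpa using hab) (by simpa using hm) fun e he => ?_
  have := hE e he
  split at this
  · rename_i x y hx hy
    simp only [Bool.and_eq_true, bne_iff_ne, ne_eq, List.contains_iff_mem] at this
    refine ⟨⟨x, hlt x (List.mem_of_getElem? hx)⟩, ?_, ⟨y, hlt y (List.mem_of_getElem? hy)⟩, ?_,
      ?_, this.2⟩
    · simp [List.getElem?_pmap, hx]
    · simp [List.getElem?_pmap, hy]
    · simpa [Fin.ext_iff] using this.1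
  · simp at this

theorem isContained_of_searchCopy {m m' : ℕ} {E E' : List (ℕ × ℕ)} {k : ℕ} {s : List ℕ}
    (h : searchCopy m E m' E' k s = true) : edgeGraph m E ⊑ edgeGraph m' E' := by
  induction k generalizing s with
  | zero => exact isContained_of_isCopy h
  | succ k ih =>
    simp only [searchCopy, List.any_eq_true, Bool.and_eq_true] at h
    obtain ⟨y, -, -, h⟩ := h
    exact ih h

/-! ### The finite part of the classification -/

/-- Properly connected coloured graphs with two colours less than vertices: the triangle, the
four-cycle and the path on five vertices. -/
def twoSavers : List (ℕ × List ((ℕ × ℕ) × ℕ)) :=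
  [(3, [((0, 1), 0), ((0, 2), 0), ((1, 2), 0)]),
    (4, [((0, 1), 0), ((1, 2), 1), ((2, 3), 0), ((0, 3), 1)]),
    (5, [((0, 1), 0), ((1, 2), 1), ((2, 3), 2), ((3, 4), 0)])]

/-- Properly connected coloured graphs with three colours less than vertices. Every connected graph
that is neither a star, nor a double star, nor `T¹(n₁, n₂)`, nor one of the eleven exceptional
graphs contains one of them. The first three are trees: the path on six vertices, the spider with
three legs of length two, and the tree in which a vertex has two neighbours with two leaves each. -/
def threeSavers : List (ℕ × List ((ℕ × ℕ) × ℕ)) :=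
  [(6, [((0, 1), 0), ((1, 2), 1), ((2, 3), 2), ((3, 4), 0), ((4, 5), 1)]),
    (7, [((0, 1), 0), ((1, 2), 1), ((0, 3), 2), ((3, 4), 1), ((0, 5), 3), ((5, 6), 1)]),
    (7, [((0, 1), 0), ((0, 2), 1), ((1, 3), 2), ((1, 4), 3), ((2, 5), 2), ((2, 6), 3)]),
    (4, [((0, 1), 0), ((0, 2), 0), ((0, 3), 0), ((1, 2), 0), ((1, 3), 0), ((2, 3), 0)]),
    (5, [((0, 1), 0), ((1, 2), 0), ((2, 3), 1), ((3, 4), 0), ((0, 4), 1), ((0, 2), 0)]),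
    (5, [((0, 1), 0), ((0, 2), 0), ((1, 2), 0), ((0, 3), 0), ((0, 4), 1), ((1, 3), 1)]),
    (5, [((0, 1), 0), ((0, 2), 0), ((1, 2), 0), ((0, 3), 1), ((0, 4), 1), ((3, 4), 0)]),
    (5, [((0, 1), 0), ((1, 2), 0), ((2, 3), 0), ((0, 3), 1), ((0, 4), 0), ((2, 4), 1)]),
    (6, [((0, 1), 0), ((0, 2), 1), ((1, 2), 2), ((0, 3), 0), ((0, 4), 1), ((0, 5), 2)]),
    (6, [((0, 1), 0), ((0, 2), 0), ((1, 2), 1), ((0, 3), 1), ((0, 4), 2), ((1, 5), 2)]),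
    (6, [((0, 1), 0), ((0, 2), 1), ((1, 2), 2), ((0, 3), 0), ((0, 4), 1), ((3, 5), 2)]),
    (6, [((0, 1), 0), ((0, 2), 1), ((1, 2), 2), ((0, 3), 2), ((1, 4), 1), ((2, 5), 0)]),
    (6, [((0, 1), 0), ((1, 2), 1), ((2, 3), 2), ((0, 3), 0), ((0, 4), 1), ((0, 5), 2)]),
    (6, [((0, 1), 0), ((1, 2), 0), ((2, 3), 0), ((0, 3), 1), ((0, 4), 2), ((2, 5), 2)]),
    (7, [((0, 1), 0), ((0, 2), 1), ((1, 2), 2), ((0, 3), 3), ((3, 4), 0), ((3, 5), 1),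
      ((3, 6), 2)])]

/-- The eleven exceptional graphs: the unicyclic ones `C₃`, `C₄`, `C₅`, `G₁`, `G₃`, `G₄`, `G₆`,
`G₇`, `G₈`, and then `G₂` and `G₅`. -/
def exceptional : List (ℕ × List (ℕ × ℕ)) :=
  [(3, [(0, 1), (0, 2), (1, 2)]),
    (4, [(0, 1), (1, 2), (2, 3), (0, 3)]),
    (5, [(0, 1), (1, 2), (2, 3), (3, 4), (0, 4)]),
    (4, [(0, 1), (0, 2), (1, 2), (0, 3)]),
    (5, [(0, 1), (0, 2), (1, 2), (0, 3), (0, 4)]),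
    (5, [(0, 1), (0, 2), (1, 2), (0, 3), (1, 4)]),
    (5, [(0, 1), (0, 2), (1, 2), (0, 3), (3, 4)]),
    (5, [(0, 1), (1, 2), (2, 3), (0, 3), (0, 4)]),
    (6, [(0, 1), (0, 2), (1, 2), (0, 3), (3, 4), (3, 5)]),
    (4, [(0, 1), (0, 2), (0, 3), (1, 2), (1, 3)]),
    (5, [(0, 1), (0, 2), (0, 3), (1, 2), (1, 3), (2, 4)])]

theorem exceptional_sorted : ∀ P ∈ exceptional, ∀ e ∈ P.2, e.1 < e.2 ∧ e.2 < P.1 := by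
  decide

theorem twoSavers_isColoring :
    ∀ P ∈ twoSavers, 3 ≤ P.1 ∧ isColoring P.1 (P.1 - 2) P.2 = true := by
  decide +kernel

theorem threeSavers_isColoring :
    ∀ P ∈ threeSavers, 4 ≤ P.1 ∧ isColoring P.1 (P.1 - 3) P.2 = true := by
  decide +kernel

theorem exists_twoSaver_isContained_exceptional :
    ∀ P ∈ exceptional, ∃ Q ∈ twoSavers,
      searchCopy Q.1 (Q.2.map Prod.fst) P.1 P.2 Q.1 [] = true := by
  decide +kernel

theorem exceptional_hasNoColoring :
    ∀ P ∈ exceptional, hasNoColoring P.1 P.2 (P.1 - 3) = true := by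
  decide +kernel

/-- Whether `edgeGraph m E` contains one of the graphs in `threeSavers`. -/
def hasThreeSaver (m : ℕ) (E : List (ℕ × ℕ)) : Bool :=
  threeSavers.any fun Q => decide (Q.1 ≤ m) && searchCopy Q.1 (Q.2.map Prod.fst) m E Q.1 []

/-- A unicyclic exceptional graph with a pendent vertex attached contains a unicyclic exceptional
graph of the same size or a graph of `threeSavers`. -/
theorem exceptional_pendant :
    ∀ P ∈ exceptional.take 9, ∀ z ∈ List.range P.1,
      ((exceptional.take 9).any fun Q => Q.1 == P.1 + 1 &&
        searchCopy Q.1 Q.2 (P.1 + 1) (P.2 ++ [(z, P.1)]) Q.1 []) = true ∨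
      hasThreeSaver (P.1 + 1) (P.2 ++ [(z, P.1)]) = true := by
  decide +kernel

/-- An exceptional graph with an edge added is an exceptional graph, since it contains one of the
same size with as many edges, or it contains a graph of `threeSavers`. -/
theorem exceptional_edge :
    ∀ P ∈ exceptional, ∀ b ∈ List.range P.1, ∀ a ∈ List.range b, (a, b) ∉ P.2 →
      (exceptional.any fun Q => Q.1 == P.1 && Q.2.length == P.2.length + 1 &&
        searchCopy Q.1 Q.2 P.1 (P.2 ++ [(a, b)]) Q.1 []) = true ∨
      hasThreeSaver P.1 (P.2 ++ [(a, b)]) = true := by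
  decide +kernel

/-- `G` contains one of the coloured graphs in `threeSavers`. -/
def ContainsThreeSaver {V : Type*} (G : SimpleGraph V) : Prop :=
  ∃ Q ∈ threeSavers, edgeGraph Q.1 (Q.2.map Prod.fst) ⊑ G

theorem ContainsThreeSaver.mono {V W : Type*} {G : SimpleGraph V} {H : SimpleGraph W}
    (h : ContainsThreeSaver H) (hHG : H ⊑ G) : ContainsThreeSaver G := by
  obtain ⟨Q, hQ, h⟩ := h
  exact ⟨Q, hQ, h.trans hHG⟩

theorem containsThreeSaver_of_hasThreeSaver {m : ℕ} {E : List (ℕ × ℕ)}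
    (h : hasThreeSaver m E = true) : ContainsThreeSaver (edgeGraph m E) := by
  simp only [hasThreeSaver, List.any_eq_true, Bool.and_eq_true] at h
  obtain ⟨Q, hQ, -, h⟩ := h
  exact ⟨Q, hQ, isContained_of_searchCopy h⟩

/-- A graph with a cycle contains a triangle, a four-cycle, a five-cycle, or a path on six
vertices, and the last is one of `threeSavers`. -/
theorem exists_unicyclic_isContained {V : Type*} {G : SimpleGraph V} (hcyc : ¬ G.IsAcyclic)
    (hS : ¬ ContainsThreeSaver G) : ∃ P ∈ exceptional.take 9, edgeGraph P.1 P.2 ⊑ G := by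
  rw [isAcyclic_iff_free_cycleGraph] at hcyc
  push Not at hcyc
  obtain ⟨k, hk, hkG⟩ := hcyc
  have hid {m : ℕ} {E : List (ℕ × ℕ)} {H : SimpleGraph (Fin m)}
      (h : ∀ i j : Fin m, (i.val, j.val) ∈ E → i ≠ j → H.Adj i j) (hG : H ⊑ G) :
      edgeGraph m E ⊑ G :=
    IsContained.trans (edgeGraph_isContained id Function.injective_id h) hG
  rcases lt_or_ge k 6 with hk6 | hk6
  · interval_cases k
    · exact ⟨_, .head _, hid (by decide) hkG⟩
    · exact ⟨_, .tail _ (.head _), hid (by decide) hkG⟩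
    · exact ⟨_, .tail _ (.tail _ (.head _)), hid (by decide) hkG⟩
  · refine (hS ⟨_, .head _, IsContained.trans ?_ hkG⟩).elim
    refine IsContained.trans (edgeGraph_isContained (G := pathGraph k) (Fin.castLE hk6)
      (Fin.castLE_injective hk6) ?_) (.of_le pathGraph_le_cycleGraph)
    simp only [pathGraph_adj, Fin.val_castLE]
    decide

/-- A neighbour outside a copy of a graph can be attached to the copy as a pendent vertex. -/
theorem edgeGraph_pendant_isContained {V : Type*} {G : SimpleGraph V} {m : ℕ} {E : List (ℕ × ℕ)}
    (hE : ∀ e ∈ E, e.1 < e.2 ∧ e.2 < m) (f : Copy (edgeGraph m E) G) {z : Fin m} {y : V}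
    (hy : y ∉ Set.range f) (hzy : G.Adj (f z) y) :
    edgeGraph (m + 1) (E ++ [(z.val, m)]) ⊑ G := by
  refine edgeGraph_isContained (Fin.snoc (α := fun _ => V) f y)
    (Fin.snoc_injective_iff.2 ⟨f.injective, hy⟩) fun i j he hij => ?_
  rw [List.mem_append, List.mem_singleton, Prod.mk.injEq] at he
  rcases he with he | ⟨hi, hj⟩
  · obtain ⟨hlt, hm⟩ := hE _ he
    obtain ⟨i, rfl⟩ : ∃ i', Fin.castSucc i' = i := ⟨⟨i, hlt.trans hm⟩, rfl⟩
    obtain ⟨j, rfl⟩ : ∃ j', Fin.castSucc j' = j := ⟨⟨j, hm⟩, rfl⟩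
    rw [Fin.snoc_castSucc, Fin.snoc_castSucc]
    refine f.toHom.map_adj ⟨fun h => hij (congrArg _ h), ?_⟩
    have hle : i.val ≤ j.val := hlt.le
    rw [min_eq_left hle, max_eq_right hle]
    exact he
  · obtain rfl : i = z.castSucc := Fin.ext hi
    obtain rfl : j = Fin.last m := Fin.ext hj
    rwa [Fin.snoc_castSucc, Fin.snoc_last]

theorem exists_unicyclic_spanning {V : Type*} [Fintype V] {G : SimpleGraph V} (hG : G.Connected)
    (hcyc : ¬ G.IsAcyclic) (hS : ¬ ContainsThreeSaver G) :
    ∃ P ∈ exceptional.take 9, P.1 = Fintype.card V ∧ edgeGraph P.1 P.2 ⊑ G := by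
  suffices ∀ k, ∀ P ∈ exceptional.take 9, edgeGraph P.1 P.2 ⊑ G → Fintype.card V - P.1 = k →
      ∃ P ∈ exceptional.take 9, P.1 = Fintype.card V ∧ edgeGraph P.1 P.2 ⊑ G by
    obtain ⟨P, hP, hPG⟩ := exists_unicyclic_isContained hcyc hS
    exact this _ P hP hPG rfl
  intro k
  induction k with
  | zero =>
    rintro P hP ⟨f⟩ hk
    have := Fintype.card_le_of_injective f f.injective
    rw [Fintype.card_fin] at this
    exact ⟨P, hP, by omega, ⟨f⟩⟩
  | succ k ih =>
    rintro P hP ⟨f⟩ hk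
    have hPmem := List.mem_of_mem_take hP
    have hpos : 0 < P.1 := by
      have := (by decide : ∀ P ∈ exceptional, 0 < P.1)
      exact this P hPmem
    have hne : Set.range f ≠ Set.univ := fun h => by
      have := Fintype.card_le_of_surjective f (Set.range_eq_univ.1 h)
      rw [Fintype.card_fin] at this
      omega
    obtain ⟨_, ⟨z, rfl⟩, y, hy, hzy⟩ := exists_adj_notMem hG
      ⟨f ⟨0, hpos⟩, Set.mem_range_self _⟩ hne
    have hpend := edgeGraph_pendant_isContained (exceptional_sorted P hPmem) f hy hzy
    rcases exceptional_pendant P hP z (List.mem_range.2 z.2) with h | h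
    · simp only [List.any_eq_true, Bool.and_eq_true, beq_iff_eq] at h
      obtain ⟨Q, hQ, hcard, hQP⟩ := h
      exact ih Q hQ ((isContained_of_searchCopy hQP).trans hpend) (by omega)
    · exact (hS ((containsThreeSaver_of_hasThreeSaver h).mono hpend)).elim

/-- A connected graph with a cycle that contains no graph of `threeSavers` is exceptional: a
spanning copy of an exceptional graph with as many edges as possible is the whole graph. -/
theorem exists_iso_exceptional {V : Type*} [Fintype V] {G : SimpleGraph V} (hG : G.Connected)
    (hcyc : ¬ G.IsAcyclic) (hS : ¬ ContainsThreeSaver G) :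
    ∃ P ∈ exceptional, Nonempty (G ≃g edgeGraph P.1 P.2) := by
  classical
  let candidates := exceptional.toFinset.filter
    fun P => P.1 = Fintype.card V ∧ edgeGraph P.1 P.2 ⊑ G
  have hcand : candidates.Nonempty := by
    obtain ⟨P, hP, h⟩ := exists_unicyclic_spanning hG hcyc hS
    exact ⟨P, by simpa [candidates, h] using List.mem_of_mem_take hP⟩
  obtain ⟨P, hP, hmax⟩ := candidates.exists_max_image (fun P => P.2.length) hcand
  simp only [candidates, Finset.mem_filter, List.mem_toFinset] at hP hmax
  obtain ⟨hP, hcard, ⟨f⟩⟩ := hP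
  have hbij : Function.Bijective f :=
    (Fintype.bijective_iff_injective_and_card f).2 ⟨f.injective, by simpa using hcard⟩
  have hedge : ∀ i j : Fin P.1, i < j → G.Adj (f i) (f j) → (i.val, j.val) ∈ P.2 := by
    intro i j hlt hadj
    by_contra hnot
    have hadd : edgeGraph P.1 (P.2 ++ [(i.val, j.val)]) ⊑ G := by
      refine edgeGraph_isContained f f.injective fun a b he hab => ?_
      rw [List.mem_append, List.mem_singleton, Prod.mk.injEq] at he
      rcases he with he | ⟨ha, hb⟩
      · refine f.toHom.map_adj ⟨hab, ?_⟩
        have hle : a.val ≤ b.val := (exceptional_sorted P hP _ he).1.le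
        rwa [min_eq_left hle, max_eq_right hle]
      · rwa [Fin.ext ha, Fin.ext hb]
    rcases exceptional_edge P hP j (List.mem_range.2 j.2) i (List.mem_range.2 hlt) hnot with h | h
    · simp only [List.any_eq_true, Bool.and_eq_true, beq_iff_eq] at h
      obtain ⟨Q, hQ, ⟨hQcard, hQlen⟩, hQP⟩ := h
      have := hmax Q ⟨hQ, hQcard.trans hcard, (isContained_of_searchCopy hQP).trans hadd⟩
      omega
    · exact hS ((containsThreeSaver_of_hasThreeSaver h).mono hadd)
  refine ⟨P, hP, ⟨RelIso.symm ⟨Equiv.ofBijective f hbij, ?_⟩⟩⟩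
  intro i j
  refine ⟨fun h => ⟨fun hij => h.ne (congrArg f hij), ?_⟩, fun h => f.toHom.map_adj h⟩
  rcases lt_trichotomy i j with hlt | rfl | hlt
  · have hle : i.val ≤ j.val := hlt.le
    rw [min_eq_left hle, max_eq_right hle]
    exact hedge i j hlt h
  · exact (h.ne rfl).elim
  · have hle : j.val ≤ i.val := hlt.le
    rw [min_eq_right hle, max_eq_left hle]
    exact hedge j i hlt h.symm

/-! ### Trees -/

/-- A spanning copy of a connected graph in an acyclic graph is the whole graph. -/
theorem nonempty_iso_of_isContained {V W : Type*} [Fintype V] [Fintype W] {G : SimpleGraph V}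
    {H : SimpleGraph W} (hG : G.IsAcyclic) (hH : H.Connected) (hHG : H ⊑ G)
    (hcard : Fintype.card W = Fintype.card V) : Nonempty (G ≃g H) := by
  obtain ⟨f⟩ := hHG
  have hbij : Function.Bijective f :=
    (Fintype.bijective_iff_injective_and_card f).2 ⟨f.injective, hcard⟩
  refine ⟨RelIso.symm ⟨Equiv.ofBijective f hbij, ?_⟩⟩
  intro i j
  refine ⟨fun h => ?_, fun h => f.toHom.map_adj h⟩
  have h : G.Adj (f i) (f j) := h
  obtain ⟨p, hp⟩ := (hH.preconnected i j).exists_isPath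
  have := (hG.subsingleton_path _ _).elim ⟨p.map f.toHom, hp.map f.injective⟩
    (Path.singleton h)
  have hlen : p.length = 1 := by
    simpa using congrArg (fun q : G.Path (f i) (f j) => (q : G.Walk (f i) (f j)).length) this
  exact Walk.adj_of_length_eq_one hlen

/-- In an acyclic graph every path is forced to be distance `2`-proper, so the edges at the two ends
of an edge `uv` have different colours. Here `D` is a set of further ends of such edges. -/
theorem card_le_of_isAcyclic {V : Type*} {G : SimpleGraph V} (hG : G.IsAcyclic) {t : ℕ}
    (ht : ColorableWith G t) {u v : V} (huv : G.Adj u v) (D : Finset V)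
    (hD : ∀ x ∈ D, x ≠ u ∧ (G.Adj u x ∨ G.Adj v x)) : D.card ≤ t := by
  classical
  obtain ⟨c, hc, hp⟩ := ht
  have hspread : ∀ {x y : V} (p : G.Walk x y), p.IsPath → IsSpread (p.edges.map c) := by
    intro x y p hpath
    obtain ⟨q, hq, hs⟩ := hp x y
    have : p = q := congrArg Subtype.val ((hG.subsingleton_path x y).elim ⟨p, hpath⟩ ⟨q, hq⟩)
    rwa [this]
  have h2 : ∀ {x y z : V}, G.Adj x y → G.Adj y z → x ≠ z → c s(x, y) ≠ c s(y, z) := by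
    intro x y z hxy hyz hxz
    have := hspread (.cons hxy (.cons hyz .nil)) (by simp [hxy.ne, hyz.ne, hxz])
    simpa [IsSpread] using this
  have h3 : ∀ {x y : V}, G.Adj x u → G.Adj v y → x ≠ v → u ≠ y → x ≠ y →
      c s(x, u) ≠ c s(v, y) := by
    intro x y hxu hvy hxv huy hxy
    have := hspread (.cons hxu (.cons huv (.cons hvy .nil)))
      (by simp [hxu.ne, hvy.ne, hxv, huy, hxy, huv.ne])
    simp only [Walk.edges_cons, Walk.edges_nil, List.map_cons, List.map_nil, IsSpread] at this
    intro h
    simp [h] at this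
  let g : V → ℕ := fun x => if G.Adj u x then c s(x, u) else c s(v, x)
  have hg : ∀ x ∈ D, ∀ y ∈ D, x ≠ y → G.Adj u x → g x ≠ g y := by
    intro x hx y hy hxy hux
    by_cases huy : G.Adj u y
    · simp only [g, hux, huy, if_true]
      rw [Sym2.eq_swap (a := y)]
      exact h2 hux.symm huy hxy
    · have hvy := (hD y hy).2.resolve_left huy
      simp only [g, hux, huy, if_true, if_false]
      rcases eq_or_ne x v with rfl | hxv
      · rw [Sym2.eq_swap]
        exact h2 huv hvy (hD y hy).1.symm
      · exact h3 hux.symm hvy hxv (hD y hy).1.symm hxy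
  rw [← Finset.card_range t]
  refine Finset.card_le_card_of_injOn g (fun x hx => ?_) fun x hx y hy hxy => ?_
  · simp only [g, Finset.coe_range, Set.mem_Iio]
    split_ifs with h
    · exact hc _ h.symm
    · exact hc _ ((hD x hx).2.resolve_left h)
  · by_contra hne
    by_cases hux : G.Adj u x
    · exact hg x hx y hy hne hux hxy
    · by_cases huy : G.Adj u y
      · exact hg y hy x hx (Ne.symm hne) huy hxy.symm
      · simp only [g, hux, huy, if_false] at hxy
        rw [Sym2.eq_swap] at hxy
        exact h2 ((hD x hx).2.resolve_left hux).symm ((hD y hy).2.resolve_left huy) hne hxy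

/-- A star on `k` vertices in `G`, with centre `u` and leaves `A`. -/
def HasStar {V : Type*} (G : SimpleGraph V) (k : ℕ) : Prop :=
  ∃ (u : V) (A : List V), (u :: A).Nodup ∧ (∀ x ∈ A, G.Adj u x) ∧ A.length + 1 = k

/-- A double star on `k` vertices in `G`, with centres `u`, `v` and their leaves `A`, `B`. -/
def HasDoubleStar {V : Type*} (G : SimpleGraph V) (k : ℕ) : Prop :=
  ∃ (u v : V) (A B : List V), (u :: v :: (A ++ B)).Nodup ∧ G.Adj u v ∧ (∀ x ∈ A, G.Adj u x) ∧
    (∀ x ∈ B, G.Adj v x) ∧ A ≠ [] ∧ B ≠ [] ∧ A.length + B.length + 2 = k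

/-- A tree `T¹(n₁, n₂)` on `k` vertices in `G`: the centres are `u` and `v`, the neighbours of `u`
are `v`, `a` and the leaves in `A`, those of `v` are `u` and the leaves in `B`, and `w` is the
pendent vertex at `a`. -/
def HasExtendedDoubleStar {V : Type*} (G : SimpleGraph V) (k : ℕ) : Prop :=
  ∃ (u v a w : V) (A B : List V), (u :: v :: a :: w :: (A ++ B)).Nodup ∧ G.Adj u v ∧ G.Adj u a ∧
    G.Adj a w ∧ (∀ x ∈ A, G.Adj u x) ∧ (∀ x ∈ B, G.Adj v x) ∧ B ≠ [] ∧
    A.length + B.length + 4 = k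

theorem exists_adj_notMem_list {V : Type*} [Fintype V] {G : SimpleGraph V} (hG : G.Connected)
    {l : List V} (hl : l ≠ []) (hlen : l.length < Fintype.card V) :
    ∃ x ∈ l, ∃ y ∉ l, G.Adj x y := by
  classical
  refine exists_adj_notMem hG (S := {x | x ∈ l}) ?_ fun h => ?_
  · exact List.exists_mem_of_ne_nil l hl
  · have : l.toFinset = Finset.univ := by
      ext x
      simpa using (Set.ext_iff.1 h x)
    have := l.toFinset_card_le
    simp_all
    omega

/-- Used for lists whose entries are, up to order, among those of a list without repetitions. -/
theorem nodup_of_count_le {V : Type*} [DecidableEq V] {l l' : List V} (hl : l.Nodup)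
    (h : ∀ x, l'.count x ≤ l.count x) : l'.Nodup :=
  List.nodup_iff_count_le_one.2 fun x => (h x).trans (List.nodup_iff_count_le_one.1 hl x)

theorem HasStar.succ {V : Type*} [Fintype V] {G : SimpleGraph V} (hG : G.Connected) {k : ℕ}
    (h : HasStar G k) (hk : k < Fintype.card V) : HasStar G (k + 1) ∨ HasDoubleStar G (k + 1) := by
  classical
  obtain ⟨u, A, hnd, hA, rfl⟩ := h
  obtain ⟨z, hz, y, hy, hzy⟩ := exists_adj_notMem_list hG (List.cons_ne_nil u A) hk
  replace hnd := hnd.cons hy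
  rcases List.mem_cons.1 hz with rfl | hz
  · refine .inl ⟨z, y :: A, nodup_of_count_le hnd fun x => ?_, ?_, rfl⟩
    · simp only [List.count_cons]; omega
    · simpa [hzy] using hA
  · have huz := hA z hz
    obtain ⟨A₁, A₂, rfl⟩ := List.append_of_mem hz
    by_cases hA' : A₁ ++ A₂ = []
    · obtain ⟨rfl, rfl⟩ := List.append_eq_nil_iff.1 hA'
      refine .inl ⟨z, [u, y], nodup_of_count_le hnd fun x => ?_, ?_, rfl⟩
      · simp only [List.count_cons, List.count_append]; omega
      · simp [huz.symm, hzy]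
    · refine .inr ⟨u, z, A₁ ++ A₂, [y], nodup_of_count_le hnd fun x => ?_, huz, fun x hx => ?_,
        ?_, hA', by simp, ?_⟩
      · simp only [List.count_cons, List.count_append, List.count_nil]; omega
      · refine hA x ?_
        simp only [List.mem_append, List.mem_cons] at hx ⊢
        tauto
      · simpa using hzy
      · simp only [List.length_append, List.length_cons, List.length_nil]; omega

theorem HasDoubleStar.succ {V : Type*} [Fintype V] {G : SimpleGraph V} (hG : G.Connected) {k : ℕ}
    (h : HasDoubleStar G k) (hk : k < Fintype.card V) :
    HasDoubleStar G (k + 1) ∨ HasExtendedDoubleStar G (k + 1) := by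
  classical
  obtain ⟨u, v, A, B, hnd, huv, hA, hB, hA', hB', rfl⟩ := h
  obtain ⟨z, hz, y, hy, hzy⟩ := exists_adj_notMem_list hG (l := u :: v :: (A ++ B)) (by simp)
    (by simpa [add_assoc] using hk)
  replace hnd := hnd.cons hy
  -- A vertex attached to a leaf of one centre: the other centre and its leaves stay as they are.
  have hleaf : ∀ {u v : V} {A B : List V}, (y :: u :: v :: (A ++ B)).Nodup → G.Adj u v →
      (∀ x ∈ A, G.Adj u x) → (∀ x ∈ B, G.Adj v x) → B ≠ [] → z ∈ A →
      HasExtendedDoubleStar G (A.length + B.length + 2 + 1) := by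
    intro u v A B hnd huv hA hB hB' hz
    have huz := hA z hz
    obtain ⟨A₁, A₂, rfl⟩ := List.append_of_mem hz
    refine ⟨u, v, z, y, A₁ ++ A₂, B, nodup_of_count_le hnd fun x => ?_, huv, huz, hzy,
      fun x hx => ?_, hB, hB', ?_⟩
    · simp only [List.count_cons, List.count_append]; omega
    · refine hA x ?_
      simp only [List.mem_append, List.mem_cons] at hx ⊢
      tauto
    · simp only [List.length_append, List.length_cons]; omega
  simp only [List.mem_cons, List.mem_append] at hz
  rcases hz with rfl | rfl | hz | hz
  · refine .inl ⟨z, v, y :: A, B, nodup_of_count_le hnd fun x => ?_, huv, ?_, hB, by simp, hB', ?_⟩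
    · simp only [List.count_cons, List.count_append]; omega
    · simpa [hzy] using hA
    · simp only [List.length_cons]; omega
  · refine .inl ⟨u, z, A, y :: B, nodup_of_count_le hnd fun x => ?_, huv, hA, ?_, hA', by simp, ?_⟩
    · simp only [List.count_cons, List.count_append]; omega
    · simpa [hzy] using hB
    · simp only [List.length_cons]; omega
  · exact .inr (hleaf hnd huv hA hB hB' hz)
  · rw [add_comm A.length]
    refine .inr (hleaf (nodup_of_count_le hnd fun x => ?_) huv.symm hB hA hA' hz)
    simp only [List.count_cons, List.count_append]; omega

/-- A vertex attached to a tree `T¹(n₁, n₂)` gives such a tree again if it is attached to a centre,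
or to `a` when `v` has a single leaf. In the other cases one of the three trees in `threeSavers`
appears. -/
theorem HasExtendedDoubleStar.succ {V : Type*} [Fintype V] {G : SimpleGraph V} (hG : G.Connected)
    {k : ℕ} (h : HasExtendedDoubleStar G k) (hk : k < Fintype.card V)
    (hS : ¬ ContainsThreeSaver G) : HasExtendedDoubleStar G (k + 1) := by
  classical
  obtain ⟨u, v, a, w, A, B, hnd, huv, hua, haw, hA, hB, hB', rfl⟩ := h
  obtain ⟨z, hz, y, hy, hzy⟩ := exists_adj_notMem_list hG (l := u :: v :: a :: w :: (A ++ B))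
    (by simp) (by simpa [add_assoc] using hk)
  replace hnd := hnd.cons hy
  obtain ⟨b, hb⟩ := List.exists_mem_of_ne_nil B hB'
  have hvb := hB b hb
  simp only [List.mem_cons, List.mem_append] at hz
  rcases hz with rfl | rfl | rfl | rfl | hz | hz
  · refine ⟨z, v, a, w, y :: A, B, nodup_of_count_le hnd fun x => ?_, huv, hua, haw, ?_, hB, hB',
      ?_⟩
    · simp only [List.count_cons, List.count_append]; omega
    · simpa [hzy] using hA
    · simp only [List.length_cons]; omega
  · refine ⟨u, z, a, w, A, y :: B, nodup_of_count_le hnd fun x => ?_, huv, hua, haw, hA, ?_,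
      by simp, ?_⟩
    · simp only [List.count_cons, List.count_append]; omega
    · simpa [hzy] using hB
    · simp only [List.length_cons]; omega
  · rcases B with - | ⟨b, - | ⟨b', B⟩⟩
    · simp at hB'
    · -- Now `u` and `z` are the centres, and `b` is the pendent vertex at `v`.
      simp only [List.mem_singleton, forall_eq] at hB
      refine ⟨u, z, v, b, A, [w, y], nodup_of_count_le hnd fun x => ?_, hua, huv, hB, hA, ?_,
        by simp, ?_⟩
      · simp only [List.count_cons, List.count_append]; omega
      · simp [haw, hzy]
      · simp only [List.length_cons, List.length_nil]
    · simp only [List.mem_cons, forall_eq_or_imp] at hB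
      refine (hS ⟨_, .tail _ (.tail _ (.head _)), edgeGraph_isContained_of_list
        [u, z, v, w, y, b, b'] (nodup_of_count_le hnd fun x => ?_) rfl ?_⟩).elim
      · simp only [List.count_cons, List.count_append, List.count_nil]; omega
      · simp [hua, huv, haw, hzy, hB]
  · obtain ⟨B₁, B₂, rfl⟩ := List.append_of_mem hb
    refine (hS ⟨_, .head _, edgeGraph_isContained_of_list [y, z, a, u, v, b]
      (nodup_of_count_le hnd fun x => ?_) rfl ?_⟩).elim
    · simp only [List.count_cons, List.count_append, List.count_nil]; omega
    · simp [hzy.symm, haw.symm, hua.symm, huv, hvb]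
  · have huz := hA z hz
    obtain ⟨B₁, B₂, rfl⟩ := List.append_of_mem hb
    obtain ⟨A₁, A₂, rfl⟩ := List.append_of_mem hz
    refine (hS ⟨_, .tail _ (.head _), edgeGraph_isContained_of_list [u, a, w, v, b, z, y]
      (nodup_of_count_le hnd fun x => ?_) rfl ?_⟩).elim
    · simp only [List.count_cons, List.count_append, List.count_nil]; omega
    · simp [hua, haw, huv, hvb, huz, hzy]
  · have hvz := hB z hz
    obtain ⟨B₁, B₂, rfl⟩ := List.append_of_mem hz
    refine (hS ⟨_, .head _, edgeGraph_isContained_of_list [y, z, v, u, a, w]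
      (nodup_of_count_le hnd fun x => ?_) rfl ?_⟩).elim
    · simp only [List.count_cons, List.count_append, List.count_nil]; omega
    · simp [hzy.symm, hvz.symm, huv.symm, hua, haw]

/-- A connected graph without a graph of `threeSavers` is spanned by a star, a double star
or a tree `T¹(n₁, n₂)`. -/
theorem exists_spanning_tree {V : Type*} [Fintype V] {G : SimpleGraph V} (hG : G.Connected)
    (hS : ¬ ContainsThreeSaver G) :
    HasStar G (Fintype.card V) ∨ HasDoubleStar G (Fintype.card V) ∨
      HasExtendedDoubleStar G (Fintype.card V) := by
  have hpos : 1 ≤ Fintype.card V := Fintype.card_pos_iff.2 hG.nonempty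
  suffices ∀ k, 1 ≤ k → k ≤ Fintype.card V →
      HasStar G k ∨ HasDoubleStar G k ∨ HasExtendedDoubleStar G k from this _ hpos le_rfl
  intro k hk
  induction k, hk using Nat.le_induction with
  | base => exact fun _ => .inl ⟨hG.nonempty.some, [], by simp, by simp, rfl⟩
  | succ k _ ih =>
    intro hk
    rcases ih (by omega) with h | h | h
    · exact (h.succ hG hk).imp_right .inl
    · exact .inr (h.succ hG hk)
    · exact .inr (.inr (h.succ hG hk hS))

/-- A graph is a tree with root `r` if every other vertex `x` is adjacent to its parent `p x`, which
is at a smaller height, and there are no further edges. -/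
theorem isTree_of_parent {V : Type*} {G : SimpleGraph V} {r : V} (p : V → V) (h : V → ℕ)
    (hr : p r = r) (hp : ∀ x, x ≠ r → G.Adj x (p x) ∧ h (p x) < h x)
    (hadj : ∀ x y, G.Adj x y → y = p x ∨ x = p y) : G.IsTree := by
  classical
  refine ⟨?_, ?_⟩
  · refine connected_iff_exists_forall_reachable _ |>.2 ⟨r, fun x => ?_⟩
    induction hx : h x using Nat.strong_induction_on generalizing x with
    | _ n ih =>
      rcases eq_or_ne x r with rfl | hxr
      · rfl
      · obtain ⟨hxp, hlt⟩ := hp x hxr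
        exact (ih _ (hx ▸ hlt) _ rfl).trans hxp.symm.reachable
  · -- A highest vertex of a cycle would have two neighbours on it, but only one parent.
    have hparent : ∀ x y, G.Adj x y → h y ≤ h x → y = p x := by
      intro x y hxy hle
      refine (hadj x y hxy).resolve_right fun hx => ?_
      have hyr : y ≠ r := by
        rintro rfl
        exact hxy.ne (hx.trans hr)
      have := (hp y hyr).2
      rw [← hx] at this
      omega
    intro v c hc
    obtain ⟨x, hx, hmax⟩ := c.support.toFinset.exists_max_image h ⟨v, by simp⟩
    simp only [List.mem_toFinset] at hx hmax
    have hq := hc.rotate hx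
    have hnn := hq.not_nil
    have hle : ∀ y ∈ (c.rotate x hx).support, h y ≤ h x := fun y hy =>
      hmax y ((Walk.mem_support_rotate_iff _ _ hx).1 hy)
    exact hq.snd_ne_penultimate <|
      (hparent x _ (Walk.adj_snd hnn) (hle _ (Walk.getVert_mem_support ..))).trans
      (hparent x _ (Walk.adj_penultimate hnn).symm (hle _ (Walk.getVert_mem_support ..))).symm

/-! ### Stars, double stars and the trees `T¹(n₁, n₂)` -/

theorem HasStar.isContained {V : Type*} {G : SimpleGraph V} {k : ℕ} (h : HasStar G k) :
    completeBipartiteGraph (Fin 1) (Fin (k - 1)) ⊑ G := by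
  obtain ⟨u, A, hnd, hA, rfl⟩ := h
  rw [List.nodup_cons] at hnd
  rw [Nat.add_sub_cancel]
  refine ⟨⟨⟨Sum.elim (fun _ => u) A.get, ?_⟩, ?_⟩⟩
  · rintro (i | i) (j | j) hij
    · simp at hij
    · exact hA _ (A.get_mem j)
    · exact (hA _ (A.get_mem i)).symm
    · simp at hij
  · refine Function.Injective.sumElim (Function.injective_of_subsingleton _)
      (List.nodup_iff_injective_get.1 hnd.2) fun _ i hu => hnd.1 ?_
    rw [hu]
    exact A.get_mem i

/-- The copy of a double star with centres `u`, `v` and leaves `A`, `B`. -/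
def doubleStarVertex {V : Type*} (u v : V) (A B : List V) :
    Fin 2 ⊕ (Fin A.length ⊕ Fin B.length) → V :=
  Sum.elim ![u, v] (Sum.elim A.get B.get)

theorem doubleStarVertex_injective {V : Type*} {u v : V} {A B : List V}
    (hnd : (u :: v :: (A ++ B)).Nodup) : Function.Injective (doubleStarVertex u v A B) := by
  simp only [List.nodup_cons, List.nodup_append, List.mem_cons, List.mem_append, not_or] at hnd
  obtain ⟨⟨huv, huA, huB⟩, ⟨hvA, hvB⟩, hA, hB, hAB⟩ := hnd
  refine Function.Injective.sumElim ?_ (Function.Injective.sumElim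
    (List.nodup_iff_injective_get.1 hA) (List.nodup_iff_injective_get.1 hB)
    fun i j => hAB _ (A.get_mem i) _ (B.get_mem j)) ?_
  · intro i j
    fin_cases i <;> fin_cases j <;> simp [huv, Ne.symm huv]
  · rintro i (j | j) h
    · have hj : ![u, v] i ∈ A := by rw [h]; exact A.get_mem j
      fin_cases i
      · exact huA hj
      · exact hvA hj
    · have hj : ![u, v] i ∈ B := by rw [h]; exact B.get_mem j
      fin_cases i
      · exact huB hj
      · exact hvB hj

theorem doubleStarVertex_adj {V : Type*} {G : SimpleGraph V} {u v : V} {A B : List V}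
    (huv : G.Adj u v) (hA : ∀ x ∈ A, G.Adj u x) (hB : ∀ x ∈ B, G.Adj v x)
    {x y : Fin 2 ⊕ (Fin A.length ⊕ Fin B.length)} (hxy : (doubleStar A.length B.length).Adj x y) :
    G.Adj (doubleStarVertex u v A B x) (doubleStarVertex u v A B y) := by
  have hA' := fun i => hA _ (A.get_mem i)
  have hB' := fun i => hB _ (B.get_mem i)
  rw [doubleStar, fromRel_adj] at hxy
  rcases x with x | x | x <;> rcases y with y | y | y
  · fin_cases x <;> fin_cases y <;> simp_all [doubleStarVertex, huv.symm]
  all_goals simp_all [doubleStarVertex, G.adj_comm]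

theorem HasDoubleStar.isContained {V : Type*} {G : SimpleGraph V} {k : ℕ}
    (h : HasDoubleStar G k) :
    ∃ n₁ n₂ : ℕ, 1 ≤ n₁ ∧ 1 ≤ n₂ ∧ n₁ + n₂ + 2 = k ∧ doubleStar n₁ n₂ ⊑ G := by
  obtain ⟨u, v, A, B, hnd, huv, hA, hB, hA', hB', hk⟩ := h
  exact ⟨A.length, B.length, List.length_pos_iff.2 hA', List.length_pos_iff.2 hB', hk,
    ⟨⟨⟨_, doubleStarVertex_adj huv hA hB⟩, doubleStarVertex_injective hnd⟩⟩⟩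

theorem extendedDoubleStar_adj_some {n₁ n₂ : ℕ} {x y : Fin 2 ⊕ (Fin n₁ ⊕ Fin n₂)} :
    (extendedDoubleStar n₁ n₂).Adj (some x) (some y) ↔ (doubleStar n₁ n₂).Adj x y := by
  simp only [extendedDoubleStar, fromRel_adj, adj_comm _ y x, or_self, ne_eq, Option.some.injEq]
  exact ⟨And.right, fun h => ⟨h.ne, h⟩⟩

theorem extendedDoubleStar_adj_none {n₁ n₂ : ℕ} (h : 1 ≤ n₁) {y : Fin 2 ⊕ (Fin n₁ ⊕ Fin n₂)} :
    (extendedDoubleStar n₁ n₂).Adj none (some y) ↔ y = .inr (.inl ⟨0, h⟩) := by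
  rcases y with y | y | y <;> simp [extendedDoubleStar, Fin.ext_iff]

theorem HasExtendedDoubleStar.isContained {V : Type*} {G : SimpleGraph V} {k : ℕ}
    (h : HasExtendedDoubleStar G k) :
    ∃ n₁ n₂ : ℕ, 1 ≤ n₁ ∧ 1 ≤ n₂ ∧ n₁ + n₂ + 3 = k ∧ extendedDoubleStar n₁ n₂ ⊑ G := by
  classical
  obtain ⟨u, v, a, w, A, B, hnd, huv, hua, haw, hA, hB, hB', hk⟩ := h
  have hnd' : (w :: u :: v :: ((a :: A) ++ B)).Nodup := nodup_of_count_le hnd fun x => by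
    simp only [List.count_cons, List.count_append]; omega
  rw [List.nodup_cons] at hnd'
  refine ⟨(a :: A).length, B.length, by simp, List.length_pos_iff.2 hB', by simp; omega,
    ⟨⟨⟨fun x => x.elim w (doubleStarVertex u v (a :: A) B), ?_⟩, ?_⟩⟩⟩
  · have hA' : ∀ x ∈ a :: A, G.Adj u x := by simpa [hua] using hA
    have hw : ∀ y, (extendedDoubleStar (a :: A).length B.length).Adj none (some y) →
        G.Adj w (doubleStarVertex u v (a :: A) B y) := by
      intro y h
      rw [(extendedDoubleStar_adj_none (by simp)).1 h]
      exact haw.symm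
    rintro (_ | x) (_ | y) hxy
    · simp at hxy
    · exact hw y hxy
    · exact (hw x hxy.symm).symm
    · exact doubleStarVertex_adj huv hA' hB (extendedDoubleStar_adj_some.1 hxy)
  · have hmem : ∀ y, doubleStarVertex u v (a :: A) B y ∈ u :: v :: ((a :: A) ++ B) := by
      rintro (y | y | y)
      · fin_cases y <;> simp [doubleStarVertex]
      · exact List.mem_cons_of_mem _ (List.mem_cons_of_mem _
          (List.mem_append_left _ ((a :: A).get_mem y)))
      · exact List.mem_cons_of_mem _ (List.mem_cons_of_mem _
          (List.mem_append_right _ (B.get_mem y)))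
    rintro (_ | x) (_ | y) hxy
    · rfl
    · have hw : w = doubleStarVertex u v (a :: A) B y := hxy
      exact (hnd'.1 (hw ▸ hmem y)).elim
    · have hw : doubleStarVertex u v (a :: A) B x = w := hxy
      exact (hnd'.1 (hw ▸ hmem x)).elim
    · exact congrArg some (doubleStarVertex_injective hnd'.2 hxy)

theorem star_isTree (k : ℕ) : (completeBipartiteGraph (Fin 1) (Fin k)).IsTree := by
  refine isTree_of_parent (r := .inl 0) (fun _ => .inl 0) (Sum.elim 0 1) rfl ?_ ?_
  · rintro (x | x) hx
    · exact (hx (congrArg _ (Subsingleton.elim _ _))).elim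
    · simp
  · rintro (x | x) (y | y) hxy
    · simp at hxy
    · exact .inr (congrArg _ (Subsingleton.elim _ _))
    · exact .inl (congrArg _ (Subsingleton.elim _ _))
    · simp at hxy

/-- The parent of a vertex of a double star rooted at its first centre. -/
def doubleStarParent {n₁ n₂ : ℕ} : Fin 2 ⊕ (Fin n₁ ⊕ Fin n₂) → Fin 2 ⊕ (Fin n₁ ⊕ Fin n₂) :=
  Sum.elim (fun _ => .inl 0) (Sum.elim (fun _ => .inl 0) (fun _ => .inl 1))

theorem doubleStar_adj_parent {n₁ n₂ : ℕ} {x : Fin 2 ⊕ (Fin n₁ ⊕ Fin n₂)} (hx : x ≠ .inl 0) :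
    (doubleStar n₁ n₂).Adj x (doubleStarParent x) ∧
      Sum.elim Fin.val (fun _ => 2) (doubleStarParent x) < Sum.elim Fin.val (fun _ => 2) x := by
  rcases x with x | x | x
  · fin_cases x
    · simp at hx
    · simp [doubleStar, doubleStarParent]
  · simp [doubleStar, doubleStarParent]
  · simp [doubleStar, doubleStarParent]

theorem eq_parent_of_doubleStar_adj {n₁ n₂ : ℕ} {x y : Fin 2 ⊕ (Fin n₁ ⊕ Fin n₂)}
    (hxy : (doubleStar n₁ n₂).Adj x y) : y = doubleStarParent x ∨ x = doubleStarParent y := by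
  rcases x with x | x | x <;> rcases y with y | y | y
  · fin_cases x <;> fin_cases y <;> simp_all [doubleStar, doubleStarParent]
  all_goals simp_all [doubleStar, doubleStarParent]

theorem doubleStar_isTree (n₁ n₂ : ℕ) : (doubleStar n₁ n₂).IsTree :=
  isTree_of_parent doubleStarParent _ rfl (fun _ => doubleStar_adj_parent)
    fun _ _ => eq_parent_of_doubleStar_adj

theorem extendedDoubleStar_isTree {n₁ n₂ : ℕ} (h : 1 ≤ n₁) : (extendedDoubleStar n₁ n₂).IsTree := by
  refine isTree_of_parent (r := some (.inl 0))
    (fun x => some (x.elim (.inr (.inl ⟨0, h⟩)) doubleStarParent))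
    (fun x => x.elim 3 (Sum.elim Fin.val fun _ => 2)) rfl ?_ ?_
  · rintro (_ | x) hx
    · exact ⟨(extendedDoubleStar_adj_none h).2 rfl, by simp⟩
    · obtain ⟨hadj, hlt⟩ := doubleStar_adj_parent fun h => hx (congrArg some h)
      exact ⟨extendedDoubleStar_adj_some.2 hadj, hlt⟩
  · rintro (_ | x) (_ | y) hxy
    · simp at hxy
    · exact .inl (congrArg some ((extendedDoubleStar_adj_none h).1 hxy))
    · exact .inr (congrArg some ((extendedDoubleStar_adj_none h).1 hxy.symm))
    · exact (eq_parent_of_doubleStar_adj (extendedDoubleStar_adj_some.1 hxy)).imp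
        (congrArg some) (congrArg some)

/-! ### The values of the proper connection number -/

theorem properConnectionNumber_eq_of {V : Type*} {G : SimpleGraph V} {k : ℕ}
    (h : ColorableWith G k) (h' : ∀ t, ColorableWith G t → k ≤ t) :
    properConnectionNumber 1 2 G = k := by
  rw [properConnectionNumber_eq]
  exact le_antisymm (Nat.sInf_le h) (le_csInf ⟨k, h⟩ h')

theorem colorableWith_card_sub_one {V : Type*} [Fintype V] {G : SimpleGraph V} (hG : G.Connected)
    (hV : 2 ≤ Fintype.card V) : ColorableWith G (Fintype.card V - 1) := by
  have : Nontrivial V := Fintype.one_lt_card_iff_nontrivial.1 hV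
  obtain ⟨v⟩ := hG.nonempty
  obtain ⟨x, y, hxy⟩ : ∃ x y, G.Adj x y :=
    ⟨v, hG.preconnected.exists_adj_of_nontrivial v⟩
  have h := ColorableWith.of_isContained hG (H := edgeGraph 2 [(0, 1)])
    (edgeGraph_isContained_of_list [x, y] (by simp [hxy.ne]) rfl (by simp [hxy])) one_pos
    (colorableWith_of_isColoring (L := [((0, 1), 0)]) (by decide))
  refine h.mono ?_
  rw [Fintype.card_fin]
  omega

theorem colorableWith_card_sub_two {V : Type*} [Fintype V] {G : SimpleGraph V} (hG : G.Connected)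
    {Q : ℕ × List ((ℕ × ℕ) × ℕ)} (hQ : Q ∈ twoSavers)
    (hQG : edgeGraph Q.1 (Q.2.map Prod.fst) ⊑ G) : ColorableWith G (Fintype.card V - 2) := by
  obtain ⟨hcard, hcol⟩ := twoSavers_isColoring Q hQ
  have : Nonempty (Fin Q.1) := ⟨⟨0, by omega⟩⟩
  refine (ColorableWith.of_isContained hG hQG (by omega) (colorableWith_of_isColoring hcol)).mono ?_
  obtain ⟨f⟩ := hQG
  have := Fintype.card_le_of_injective f f.injective
  rw [Fintype.card_fin] at this ⊢
  omega

theorem ContainsThreeSaver.properConnectionNumber_add_le {V : Type*} [Fintype V]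
    {G : SimpleGraph V} (hG : G.Connected) (h : ContainsThreeSaver G) :
    properConnectionNumber 1 2 G + 3 ≤ Fintype.card V := by
  obtain ⟨Q, hQ, hQG⟩ := h
  obtain ⟨hcard, hcol⟩ := threeSavers_isColoring Q hQ
  have : Nonempty (Fin Q.1) := ⟨⟨0, by omega⟩⟩
  have hle := (ColorableWith.of_isContained hG hQG (by omega)
    (colorableWith_of_isColoring hcol)).properConnectionNumber_le
  obtain ⟨f⟩ := hQG
  have := Fintype.card_le_of_injective f f.injective
  rw [Fintype.card_fin] at this hle
  omega

theorem properConnectionNumber_of_iso_star {V : Type*} [Fintype V] {G : SimpleGraph V}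
    (hG : G.Connected) (hV : 2 ≤ Fintype.card V)
    (e : G ≃g completeBipartiteGraph (Fin 1) (Fin (Fintype.card V - 1))) :
    properConnectionNumber 1 2 G = Fintype.card V - 1 := by
  classical
  refine properConnectionNumber_eq_of (colorableWith_card_sub_one hG hV) fun t ht => ?_
  have := card_le_of_isAcyclic (star_isTree _).isAcyclic (ht.of_iso e) (u := .inl 0)
    (v := .inr ⟨0, by omega⟩) (by simp) (Finset.univ.erase (.inl 0)) (by
      rintro (x | x) hx
      · rw [Subsingleton.elim x 0] at hx
        simp at hx
      · simp)
  simpa using this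

theorem properConnectionNumber_of_iso_doubleStar {V : Type*} [Fintype V] {G : SimpleGraph V}
    (hG : G.Connected) {n₁ n₂ : ℕ} (e : G ≃g doubleStar n₁ n₂) :
    properConnectionNumber 1 2 G = Fintype.card V - 1 := by
  classical
  have hcard := Fintype.card_congr e.toEquiv
  simp only [Fintype.card_sum, Fintype.card_fin] at hcard
  refine properConnectionNumber_eq_of (colorableWith_card_sub_one hG (by omega)) fun t ht => ?_
  have := card_le_of_isAcyclic (doubleStar_isTree _ _).isAcyclic (ht.of_iso e) (u := .inl 0)
    (v := .inl 1) (by simp [doubleStar]) (Finset.univ.erase (.inl 0)) (by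
      rintro (x | x | x) hx
      · fin_cases x
        · simp at hx
        · simp [doubleStar]
      · simp [doubleStar]
      · simp [doubleStar])
  simp only [Finset.card_erase_of_mem (Finset.mem_univ _), Finset.card_univ, Fintype.card_sum,
    Fintype.card_fin] at this
  omega

theorem properConnectionNumber_of_iso_extendedDoubleStar {V : Type*} [Fintype V]
    {G : SimpleGraph V} (hG : G.Connected) {n₁ n₂ : ℕ} (h₁ : 1 ≤ n₁) (h₂ : 1 ≤ n₂)
    (e : G ≃g extendedDoubleStar n₁ n₂) :
    properConnectionNumber 1 2 G = Fintype.card V - 2 := by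
  classical
  have hcard := Fintype.card_congr e.toEquiv
  simp only [Fintype.card_option, Fintype.card_sum, Fintype.card_fin] at hcard
  have hP5 : edgeGraph 5 [(0, 1), (1, 2), (2, 3), (3, 4)] ⊑ extendedDoubleStar n₁ n₂ :=
    edgeGraph_isContained_of_list [none, some (.inr (.inl ⟨0, h₁⟩)), some (.inl 0), some (.inl 1),
      some (.inr (.inr ⟨0, h₂⟩))] (by simp) rfl (by simp [extendedDoubleStar, doubleStar])
  refine properConnectionNumber_eq_of (colorableWith_card_sub_two hG (.tail _ (.tail _ (.head _)))
    (hP5.trans ⟨e.symm.toCopy⟩)) fun t ht => ?_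
  have := card_le_of_isAcyclic (extendedDoubleStar_isTree h₁).isAcyclic (ht.of_iso e)
    (u := some (.inl 0)) (v := some (.inl 1)) (by simp [extendedDoubleStar, doubleStar])
    ((Finset.univ.erase none).erase (some (.inl 0))) (by
      rintro (_ | x | x | x) hx
      · simp at hx
      · fin_cases x
        · simp at hx
        · simp [extendedDoubleStar, doubleStar]
      · simp [extendedDoubleStar, doubleStar]
      · simp [extendedDoubleStar, doubleStar])
  rw [Finset.card_erase_of_mem (by simp), Finset.card_erase_of_mem (by simp)] at this
  simp only [Finset.card_univ, Fintype.card_option, Fintype.card_sum, Fintype.card_fin] at this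
  omega

theorem properConnectionNumber_of_iso_exceptional {V : Type*} [Fintype V] {G : SimpleGraph V}
    (hG : G.Connected) {P : ℕ × List (ℕ × ℕ)} (hP : P ∈ exceptional)
    (e : G ≃g edgeGraph P.1 P.2) : properConnectionNumber 1 2 G = Fintype.card V - 2 := by
  have hcard := Fintype.card_congr e.toEquiv
  rw [Fintype.card_fin] at hcard
  obtain ⟨Q, hQ, hQP⟩ := exists_twoSaver_isContained_exceptional P hP
  refine properConnectionNumber_eq_of (colorableWith_card_sub_two hG hQ
    ((isContained_of_searchCopy hQP).trans ⟨e.symm.toCopy⟩)) fun t ht => ?_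
  by_contra! hlt
  exact not_colorableWith_of_hasNoColoring (exceptional_hasNoColoring P hP)
    ((ht.of_iso e).mono (by omega))

/-- A connected graph on at least two vertices that contains no graph of `threeSavers` is a star or
a double star, or it is exceptional or a tree `T¹(n₁, n₂)`. -/
theorem classification {V : Type*} [Fintype V] {G : SimpleGraph V} (hG : G.Connected)
    (hV : 2 ≤ Fintype.card V) (hS : ¬ ContainsThreeSaver G) :
    (Nonempty (G ≃g completeBipartiteGraph (Fin 1) (Fin (Fintype.card V - 1))) ∨
      ∃ n₁ n₂ : ℕ, 1 ≤ n₁ ∧ 1 ≤ n₂ ∧ Nonempty (G ≃g doubleStar n₁ n₂)) ∨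
    (∃ P ∈ exceptional, Nonempty (G ≃g edgeGraph P.1 P.2)) ∨
      ∃ n₁ n₂ : ℕ, 1 ≤ n₁ ∧ 1 ≤ n₂ ∧ Nonempty (G ≃g extendedDoubleStar n₁ n₂) := by
  by_cases hcyc : G.IsAcyclic
  · rcases exists_spanning_tree hG hS with h | h | h
    · refine .inl (.inl (nonempty_iso_of_isContained hcyc (star_isTree _).connected
        h.isContained ?_))
      simp only [Fintype.card_sum, Fintype.card_fin]
      omega
    · obtain ⟨n₁, n₂, h₁, h₂, hcard, h⟩ := h.isContained
      refine .inl (.inr ⟨n₁, n₂, h₁, h₂, nonempty_iso_of_isContained hcyc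
        (doubleStar_isTree _ _).connected h ?_⟩)
      simp only [Fintype.card_sum, Fintype.card_fin]
      omega
    · obtain ⟨n₁, n₂, h₁, h₂, hcard, h⟩ := h.isContained
      refine .inr (.inr ⟨n₁, n₂, h₁, h₂, nonempty_iso_of_isContained hcyc
        (extendedDoubleStar_isTree h₁).connected h ?_⟩)
      simp only [Fintype.card_option, Fintype.card_sum, Fintype.card_fin]
      omega
  · exact .inr (.inl (exists_iso_exceptional hG hcyc hS))

theorem exists_iso_exceptional_iff {V : Type*} {G : SimpleGraph V} :
    (∃ P ∈ exceptional, Nonempty (G ≃g edgeGraph P.1 P.2)) ↔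
      Nonempty (G ≃g cycleGraph 3) ∨ Nonempty (G ≃g cycleGraph 4) ∨ Nonempty (G ≃g cycleGraph 5) ∨
      Nonempty (G ≃g G₁) ∨ Nonempty (G ≃g G₂) ∨ Nonempty (G ≃g G₃) ∨ Nonempty (G ≃g G₄) ∨
      Nonempty (G ≃g G₅) ∨ Nonempty (G ≃g G₆) ∨ Nonempty (G ≃g G₇) ∨ Nonempty (G ≃g G₈) := by
  have hC₃ : cycleGraph 3 = edgeGraph 3 [(0, 1), (0, 2), (1, 2)] := by
    ext i j; revert i j; decide
  have hC₄ : cycleGraph 4 = edgeGraph 4 [(0, 1), (1, 2), (2, 3), (0, 3)] := by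
    ext i j; revert i j; decide
  have hC₅ : cycleGraph 5 = edgeGraph 5 [(0, 1), (1, 2), (2, 3), (3, 4), (0, 4)] := by
    ext i j; revert i j; decide
  obtain ⟨hG₁, hG₂, hG₃, hG₄, hG₅, hG₆, hG₇, hG₈⟩ :
      G₁ = edgeGraph 4 [(0, 1), (0, 2), (1, 2), (0, 3)] ∧
      G₂ = edgeGraph 4 [(0, 1), (0, 2), (0, 3), (1, 2), (1, 3)] ∧
      G₃ = edgeGraph 5 [(0, 1), (0, 2), (1, 2), (0, 3), (0, 4)] ∧
      G₄ = edgeGraph 5 [(0, 1), (0, 2), (1, 2), (0, 3), (1, 4)] ∧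
      G₅ = edgeGraph 5 [(0, 1), (0, 2), (0, 3), (1, 2), (1, 3), (2, 4)] ∧
      G₆ = edgeGraph 5 [(0, 1), (0, 2), (1, 2), (0, 3), (3, 4)] ∧
      G₇ = edgeGraph 5 [(0, 1), (1, 2), (2, 3), (0, 3), (0, 4)] ∧
      G₈ = edgeGraph 6 [(0, 1), (0, 2), (1, 2), (0, 3), (3, 4), (3, 5)] := by
    refine ⟨?_, ?_, ?_, ?_, ?_, ?_, ?_, ?_⟩ <;> ext i j <;>
      simp only [G₁, G₂, G₃, G₄, G₅, G₆, G₇, G₈, fromEdgeSet_adj, Set.mem_insert_iff,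
        Set.mem_singleton_iff] <;> revert i j <;> decide
  rw [hC₃, hC₄, hC₅, hG₁, hG₂, hG₃, hG₄, hG₅, hG₆, hG₇, hG₈]
  simp only [exceptional, List.mem_cons, List.not_mem_nil, or_false, exists_eq_or_imp,
    exists_eq_left]
  tauto

end DistanceProper

theorem theorem4p1 {V : Type*} [Fintype V] (G : SimpleGraph V) (hG : G.Connected)
    (n : ℕ) (hn : 2 ≤ n) (hV : Fintype.card V = n) :
    (DistanceProper.properConnectionNumber 1 2 G = n - 1 ↔
      Nonempty (G ≃g completeBipartiteGraph (Fin 1) (Fin (n - 1))) ∨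
      ∃ n₁ n₂ : ℕ, 1 ≤ n₁ ∧ 1 ≤ n₂ ∧ Nonempty (G ≃g DistanceProper.doubleStar n₁ n₂)) ∧
    (DistanceProper.properConnectionNumber 1 2 G = n - 2 ↔
      Nonempty (G ≃g SimpleGraph.cycleGraph 3) ∨
      Nonempty (G ≃g SimpleGraph.cycleGraph 4) ∨
      Nonempty (G ≃g SimpleGraph.cycleGraph 5) ∨
      Nonempty (G ≃g DistanceProper.G₁) ∨
      Nonempty (G ≃g DistanceProper.G₂) ∨
      Nonempty (G ≃g DistanceProper.G₃) ∨
      Nonempty (G ≃g DistanceProper.G₄) ∨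
      Nonempty (G ≃g DistanceProper.G₅) ∨
      Nonempty (G ≃g DistanceProper.G₆) ∨
      Nonempty (G ≃g DistanceProper.G₇) ∨
      Nonempty (G ≃g DistanceProper.G₈) ∨
      ∃ n₁ n₂ : ℕ, 1 ≤ n₁ ∧ 1 ≤ n₂ ∧ Nonempty (G ≃g DistanceProper.extendedDoubleStar n₁ n₂)) := by
  subst hV
  have hone : (Nonempty (G ≃g completeBipartiteGraph (Fin 1) (Fin (Fintype.card V - 1))) ∨
      ∃ n₁ n₂ : ℕ, 1 ≤ n₁ ∧ 1 ≤ n₂ ∧ Nonempty (G ≃g DistanceProper.doubleStar n₁ n₂)) →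
      DistanceProper.properConnectionNumber 1 2 G = Fintype.card V - 1 := by
    rintro (⟨⟨e⟩⟩ | ⟨n₁, n₂, -, -, ⟨e⟩⟩)
    · exact DistanceProper.properConnectionNumber_of_iso_star hG hn e
    · exact DistanceProper.properConnectionNumber_of_iso_doubleStar hG e
  have htwo : ((∃ P ∈ DistanceProper.exceptional,
      Nonempty (G ≃g DistanceProper.edgeGraph P.1 P.2)) ∨
      ∃ n₁ n₂ : ℕ, 1 ≤ n₁ ∧ 1 ≤ n₂ ∧ Nonempty (G ≃g DistanceProper.extendedDoubleStar n₁ n₂)) →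
      DistanceProper.properConnectionNumber 1 2 G = Fintype.card V - 2 := by
    rintro (⟨P, hP, ⟨e⟩⟩ | ⟨n₁, n₂, h₁, h₂, ⟨e⟩⟩)
    · exact DistanceProper.properConnectionNumber_of_iso_exceptional hG hP e
    · exact DistanceProper.properConnectionNumber_of_iso_extendedDoubleStar hG h₁ h₂ e
  rw [DistanceProper.exists_iso_exceptional_iff] at htwo
  have hcases := fun hS => DistanceProper.classification hG hn hS
  rw [DistanceProper.exists_iso_exceptional_iff] at hcases
  have hS : Fintype.card V ≤ DistanceProper.properConnectionNumber 1 2 G + 2 →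
      ¬ DistanceProper.ContainsThreeSaver G := fun h hS => by
    have := hS.properConnectionNumber_add_le hG
    omega
  refine ⟨⟨fun h => ?_, hone⟩, ⟨fun h => ?_, fun h => htwo (by simpa only [or_assoc] using h)⟩⟩
  · refine (hcases (hS (by omega))).resolve_right fun hY => ?_
    have := htwo hY
    omega
  · have hY := (hcases (hS (by omega))).resolve_left fun hX => by
      have := hone hX
      omega
    simpa only [or_assoc] using hY
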